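/- **Setting.** Let $\mathcal B$ be the ring of bounded Borel subsets of $\mathbb R$. A *b-measure* is a map $\mu\colon\mathcal B\to\mathbb R$ with $\mu(\emptyset)=0$, with $\mu(\bigcup_n A_n)=\sum_n\mu(A_n)$ for all pairwise disjoint $A_n\in\mathcal B$ such that $\bigcup_n A_n\in\mathcal B$, and with $\mu(\{t\})=0$ for all $t\in\mathbb R$. Its total variation is $|\mu|(A)=\sup\sum_{i}|\mu(A_i)|$, the supremum being over all finite Borel partitions $\{A_i\}$ of $A\in\mathcal B$. Let $\mathcal M_c^+$ be the set of locally finite regular positive Borel measures on $\mathbb R$ without atoms, let $B_j$ be the closed ball of $\mathbb R^N$ with centre $0$ and radius $j$, and write $\mathbb R^+=[0,\infty)$. Fix moduli of continuity $\omega_j\colon\mathbb R^+\to\mathbb R^+$, $j\ge1$: each $\omega_j$ is continuous and non-decreasing, $\omega_j(0)=0$ and $\omega_j\le\omega_{j+1}$. The vector space $\mathfrak{M_p}$ of *parametric b-measures* consists of all maps $y\mapsto\nu_y$ from $\mathbb R^N$ to the b-measures such that for each integer $j\ge1$ there are $m_j,l_j\in\mathcal M_c^+$ (an *$m$-bound*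 and an *$l$-bound* of $\nu$ on $B_j$) with $|\nu_y|(A)\le m_j(A)$ and $|\nu_{y_1}-\nu_{y_2}|(A)\le l_j(A)\,\omega_j(|y_1-y_2|)$ for all $A\in\mathcal B$ and $y,y_1,y_2\in B_j$. For a continuous curve $y\colon[a,b]\to\mathbb R^N$, the integral $\int_a^b d\nu_{y(s)}$ is the limit of the Riemann sums $\sum_i\nu_{y(\tau_i)}([t_i,t_{i+1}])$ over tagged partitions of $[a,b]$ as the mesh tends to $0$. The translate of $\nu\in\mathfrak{M_p}$ by $t\in\mathbb R$ is $\nu{\cdot}t\in\mathfrak{M_p}$, $(\nu{\cdot}t)_y(A)=\nu_y(A+t)$. **Topologies.** Below, $I=[q_1,q_2]$ runs over the intervals with rational endpoints $q_1<q_2$, and $j$ over the integers $j\ge1$. A *suitable set of moduli of continuity* is a family $\Theta=\{\theta_j^I\}_{j,I}$ of continuous non-decreasing functions $\theta_j^I\colon\mathbb R^+\to\mathbb R^+$ with $\theta_j^I(0)=0$ and $\theta_{j_1}^{I_1}\le\theta_{j_2}^{I_2}$ whenever $I_1\subseteq I_2$ and $j_1\le j_2$. For such $\Theta$, $\sigma_\Theta$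 is the topology on $\mathfrak{M_p}$ generated by the seminorms $$p_{I,j}(\nu)=\sup_{y\in\mathcal K_j^I}\Big|\int_I d\nu_{y(s)}\Big|,$$ where $\mathcal K_j^I$ is the set of $y\in C(I,B_j)$ with $|y(t_1)-y(t_2)|\le\theta_j^I(|t_1-t_2|)$ for all $t_1,t_2\in I$. For a countable dense set $D\subset\mathbb R^N$, $\sigma_D$ is the topology on $\mathfrak{M_p}$ generated by the seminorms $p_{I,y}(\nu)=|\nu_y(I)|$, $y\in D$. **Bounds and hull.** A family $(\mu_\alpha)$ in $\mathcal M_c^+$ is *bounded* if there is $c>0$ with $\mu_\alpha([t,t+1])\le c$ for all $t\in\mathbb R$ and all $\alpha$; it is *equicontinuous* if for every $\varepsilon>0$ there is $\delta>0$ with $\mu_\alpha([s,t])<\varepsilon$ for all $\alpha$ whenever $0\le t-s<\delta$. We say that $\nu\in\mathfrak{M_p}$ has *equicontinuous $m$-bounds* (resp. *bounded $l$-bounds*) if for every $j\ge1$ one can choose $m$-bounds (resp. $l$-bounds) on $B_j$ of the translates $\nu{\cdot}t$, $t\in\mathbb R$, that form an equicontinuous (resp. bounded) family. For a topology $\mathcal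 T$ on $\mathfrak{M_p}$, $\mathrm{Hull}_{\mathcal T}(\nu)$ is the $\mathcal T$-closure of $\{\nu{\cdot}t: t\in\mathbb R\}$ with the topology induced by $\mathcal T$. **Statement.** Let $\nu_0\in\mathfrak{M_p}$ have equicontinuous $m$-bounds, and let $\mathcal T$ be either $\sigma_\Theta$ for a suitable set of moduli of continuity $\Theta$, or $\sigma_D$ for a countable dense set $D\subset\mathbb R^N$. Then the map $$\varphi\colon\mathbb R\times\mathrm{Hull}_{\mathcal T}(\nu_0)\to\mathrm{Hull}_{\mathcal T}(\nu_0),\qquad \varphi(t,\nu)=\nu{\cdot}t,$$ is well defined and is a continuous flow: it is jointly continuous, $\varphi(0,\nu)=\nu$ and $\varphi(t+s,\nu)=\varphi(t,\varphi(s,\nu))$ for all $t,s\in\mathbb R$ and $\nu\in\mathrm{Hull}_{\mathcal T}(\nu_0)$. If, in addition, $\nu_0$ has bounded $l$-bounds, then $\mathrm{Hull}_{\mathcal T}(\nu_0)$ is compact. -/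

import Mathlib

open Set
open scoped NNReal ENNReal

/-- The ring `𝓑` of bounded Borel subsets of the real line. -/
def IsBoundedBorel (A : Set ℝ) : Prop :=
  MeasurableSet A ∧ Bornology.IsBounded A

/-- A continuous real b-measure: a real valued, countably additive set function on the ring of
bounded Borel subsets of `ℝ` that vanishes on points.  As for Mathlib's vector measures, the
function is defined on all sets, with the value `0` outside its domain, here the ring of bounded
Borel sets; so two b-measures are equal as soon as they agree on that ring. -/
structure BMeasure where
  /-- the underlying set function -/
  toFun : Set ℝ → ℝ
  junk' : ∀ A, ¬ IsBoundedBorel A → toFun A = 0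
  empty' : toFun ∅ = 0
  hasSum' : ∀ A : ℕ → Set ℝ, (∀ n, IsBoundedBorel (A n)) → Pairwise (Function.onFun Disjoint A) →
    IsBoundedBorel (⋃ n, A n) → HasSum (fun n => toFun (A n)) (toFun (⋃ n, A n))
  singleton' : ∀ t : ℝ, toFun {t} = 0

namespace BMeasure

instance : CoeFun BMeasure (fun _ => Set ℝ → ℝ) := ⟨BMeasure.toFun⟩

theorem toFun_injective : Function.Injective BMeasure.toFun := by
  rintro ⟨f, _, _, _, _⟩ ⟨g, _, _, _, _⟩ h
  simp only at h
  subst h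
  rfl

instance : Zero BMeasure :=
  ⟨{ toFun := 0
     junk' := fun _ _ => rfl
     empty' := rfl
     hasSum' := fun _ _ _ _ => hasSum_zero
     singleton' := fun _ => rfl }⟩

instance : Add BMeasure :=
  ⟨fun μ ν =>
    { toFun := μ.toFun + ν.toFun
      junk' := fun A hA => by simp [μ.junk' A hA, ν.junk' A hA]
      empty' := by simp [μ.empty', ν.empty']
      hasSum' := fun A h1 h2 h3 => (μ.hasSum' A h1 h2 h3).add (ν.hasSum' A h1 h2 h3)
      singleton' := fun t => by simp [μ.singleton' t, ν.singleton' t] }⟩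

instance : Neg BMeasure :=
  ⟨fun μ =>
    { toFun := -μ.toFun
      junk' := fun A hA => by simp [μ.junk' A hA]
      empty' := by simp [μ.empty']
      hasSum' := fun A h1 h2 h3 => (μ.hasSum' A h1 h2 h3).neg
      singleton' := fun t => by simp [μ.singleton' t] }⟩

instance : Sub BMeasure :=
  ⟨fun μ ν =>
    { toFun := μ.toFun - ν.toFun
      junk' := fun A hA => by simp [μ.junk' A hA, ν.junk' A hA]
      empty' := by simp [μ.empty', ν.empty']
      hasSum' := fun A h1 h2 h3 => (μ.hasSum' A h1 h2 h3).sub (ν.hasSum' A h1 h2 h3)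
      singleton' := fun t => by simp [μ.singleton' t, ν.singleton' t] }⟩

instance : SMul ℝ BMeasure :=
  ⟨fun c μ =>
    { toFun := c • μ.toFun
      junk' := fun A hA => by simp [μ.junk' A hA]
      empty' := by simp [μ.empty']
      hasSum' := fun A h1 h2 h3 => (μ.hasSum' A h1 h2 h3).mul_left c
      singleton' := fun t => by simp [μ.singleton' t] }⟩

instance : SMul ℕ BMeasure :=
  ⟨fun n μ =>
    { toFun := n • μ.toFun
      junk' := fun A hA => by simp [μ.junk' A hA]
      empty' := by simp [μ.empty']
      hasSum' := fun A h1 h2 h3 => (μ.hasSum' A h1 h2 h3).const_smul n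
      singleton' := fun t => by simp [μ.singleton' t] }⟩

instance : SMul ℤ BMeasure :=
  ⟨fun n μ =>
    { toFun := n • μ.toFun
      junk' := fun A hA => by simp [μ.junk' A hA]
      empty' := by simp [μ.empty']
      hasSum' := fun A h1 h2 h3 => (μ.hasSum' A h1 h2 h3).const_smul n
      singleton' := fun t => by simp [μ.singleton' t] }⟩

instance : AddCommGroup BMeasure :=
  Function.Injective.addCommGroup BMeasure.toFun toFun_injective rfl (fun _ _ => rfl)
    (fun _ => rfl) (fun _ _ => rfl) (fun _ _ => rfl) (fun _ _ => rfl)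

/-- The map that forgets that a set function is a b-measure, as an additive homomorphism. -/
def toFunHom : BMeasure →+ (Set ℝ → ℝ) where
  toFun := BMeasure.toFun
  map_zero' := rfl
  map_add' _ _ := rfl

/-- The vector space of b-measures, with the setwise operations. -/
instance : Module ℝ BMeasure :=
  Function.Injective.module ℝ toFunHom toFun_injective (fun _ _ => rfl)

/-- The translate `μ·t`, given by `(μ·t)(A) = μ(A + t)`. -/
def translate (μ : BMeasure) (t : ℝ) : BMeasure where
  toFun A := μ ((fun s => s + t) '' A)
  junk' A hA := by
    apply μ.junk'
    rintro ⟨h1, h2⟩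
    apply hA
    refine ⟨(MeasurableEquiv.addRight t).measurableSet_image.1 h1, ?_⟩
    have h := (isometry_add_right (-t)).lipschitz.isBounded_image h2
    rw [Set.image_image] at h
    have e : (fun x : ℝ => x + t + -t) '' A = A := by simp
    rwa [e] at h
  empty' := by simp [μ.empty']
  hasSum' A h1 h2 h3 := by
    have key : ∀ B : Set ℝ, IsBoundedBorel B → IsBoundedBorel ((fun s => s + t) '' B) := by
      intro B hB
      exact ⟨(MeasurableEquiv.addRight t).measurableSet_image.2 hB.1,
        (isometry_add_right t).lipschitz.isBounded_image hB.2⟩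
    rw [Set.image_iUnion]
    refine μ.hasSum' _ (fun n => key _ (h1 n)) ?_ ?_
    · intro m n hmn
      exact (Set.disjoint_image_iff (add_left_injective t)).2 (h2 hmn)
    · rw [← Set.image_iUnion]
      exact key _ h3
  singleton' s := by simp [μ.singleton']

/-- The total variation `|μ|(A)` of a b-measure on a bounded Borel set `A`: the supremum of
`∑ i, |μ (A i)|` over all finite Borel partitions of `A`. -/
noncomputable def totalVar (μ : BMeasure) (A : Set ℝ) : ℝ≥0∞ :=
  ⨆ (n : ℕ) (P : Fin n → Set ℝ) (_ : ∀ i, MeasurableSet (P i))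
    (_ : Pairwise (Function.onFun Disjoint P)) (_ : ⋃ i, P i = A),
    ∑ i, ENNReal.ofReal |μ (P i)|

theorem sum_le_totalVar (μ : BMeasure) {A : Set ℝ} {n : ℕ} (P : Fin n → Set ℝ)
    (h1 : ∀ i, MeasurableSet (P i)) (h2 : Pairwise (Function.onFun Disjoint P))
    (h3 : ⋃ i, P i = A) : ∑ i, ENNReal.ofReal |μ (P i)| ≤ μ.totalVar A := by
  unfold totalVar
  refine le_iSup_of_le n (le_iSup_of_le P ?_)
  exact le_iSup_of_le h1 (le_iSup_of_le h2 (le_iSup_of_le h3 le_rfl))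

theorem totalVar_le (μ : BMeasure) {A : Set ℝ} {C : ℝ≥0∞}
    (h : ∀ (n : ℕ) (P : Fin n → Set ℝ), (∀ i, MeasurableSet (P i)) →
      Pairwise (Function.onFun Disjoint P) → ⋃ i, P i = A →
      ∑ i, ENNReal.ofReal |μ (P i)| ≤ C) : μ.totalVar A ≤ C := by
  unfold totalVar
  exact iSup_le fun n => iSup_le fun P => iSup_le fun h1 => iSup_le fun h2 => iSup_le fun h3 =>
    h n P h1 h2 h3

theorem totalVar_zero (A : Set ℝ) : (0 : BMeasure).totalVar A = 0 := by
  refine le_antisymm (totalVar_le _ fun n P _ _ _ => ?_) zero_le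
  have : ∀ i, (0 : BMeasure) (P i) = 0 := fun i => rfl
  simp [this]

theorem totalVar_add_le (μ ν : BMeasure) (A : Set ℝ) :
    (μ + ν).totalVar A ≤ μ.totalVar A + ν.totalVar A := by
  refine totalVar_le _ fun n P h1 h2 h3 => ?_
  refine le_trans ?_ (add_le_add (μ.sum_le_totalVar P h1 h2 h3) (ν.sum_le_totalVar P h1 h2 h3))
  rw [← Finset.sum_add_distrib]
  refine Finset.sum_le_sum fun i _ => ?_
  rw [← ENNReal.ofReal_add (abs_nonneg _) (abs_nonneg _)]
  exact ENNReal.ofReal_le_ofReal (abs_add_le _ _)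

theorem totalVar_smul_le (c : ℝ) (μ : BMeasure) (A : Set ℝ) :
    (c • μ).totalVar A ≤ (‖c‖₊ : ℝ≥0∞) * μ.totalVar A := by
  refine totalVar_le _ fun n P h1 h2 h3 => ?_
  refine le_trans ?_ (mul_le_mul_right (μ.sum_le_totalVar P h1 h2 h3) _)
  rw [Finset.mul_sum]
  refine Finset.sum_le_sum fun i _ => ?_
  have h : (c • μ) (P i) = c * μ (P i) := rfl
  rw [h, abs_mul, ENNReal.ofReal_mul (abs_nonneg _), ← Real.norm_eq_abs c,
    ofReal_norm, enorm_eq_nnnorm]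

theorem totalVar_translate_le (μ : BMeasure) (t : ℝ) (A : Set ℝ) :
    (μ.translate t).totalVar A ≤ μ.totalVar ((fun s => s + t) '' A) := by
  refine totalVar_le _ fun n P h1 h2 h3 => ?_
  refine μ.sum_le_totalVar (fun i => (fun s => s + t) '' P i)
    (fun i => (MeasurableEquiv.addRight t).measurableSet_image.2 (h1 i)) ?_ ?_
  · intro i k hik
    exact (Set.disjoint_image_iff (add_left_injective t)).2 (h2 hik)
  · rw [← Set.image_iUnion, h3]

end BMeasure

/-- The class `𝓜_c⁺` of locally finite regular positive Borel measures on `ℝ` without purely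
discontinuous part, that is, without atoms. -/
def IsContMeasure (m : MeasureTheory.Measure ℝ) : Prop :=
  MeasureTheory.IsLocallyFiniteMeasure m ∧ m.Regular ∧ MeasureTheory.NullSingletonClass m

theorem isContMeasure_zero : IsContMeasure 0 :=
  ⟨inferInstance, inferInstance, ⟨fun _ => by simp⟩⟩

theorem IsContMeasure.add {m m' : MeasureTheory.Measure ℝ} (h : IsContMeasure m)
    (h' : IsContMeasure m') : IsContMeasure (m + m') := by
  obtain ⟨h1, -, h3⟩ := h
  obtain ⟨h1', -, h3'⟩ := h'
  have : MeasureTheory.IsLocallyFiniteMeasure (m + m') := by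
    refine ⟨fun x => ?_⟩
    obtain ⟨s, hs, hs'⟩ := m.finiteAt_nhds x
    obtain ⟨u, hu, hu'⟩ := m'.finiteAt_nhds x
    refine ⟨s ∩ u, Filter.inter_mem hs hu, ?_⟩
    rw [MeasureTheory.Measure.add_apply]
    exact ENNReal.add_lt_top.2
      ⟨(MeasureTheory.measure_mono Set.inter_subset_left).trans_lt hs',
        (MeasureTheory.measure_mono Set.inter_subset_right).trans_lt hu'⟩
  exact ⟨this, inferInstance, ⟨fun x => by simp [h3.measure_singleton x, h3'.measure_singleton x]⟩⟩

theorem IsContMeasure.smul {m : MeasureTheory.Measure ℝ} (h : IsContMeasure m) (c : ℝ≥0) :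
    IsContMeasure (c • m) := by
  obtain ⟨h1, -, h3⟩ := h
  have : MeasureTheory.IsLocallyFiniteMeasure (c • m) := inferInstance
  exact ⟨this, inferInstance, ⟨fun x => by simp [h3.measure_singleton x]⟩⟩

theorem IsContMeasure.map_sub {m : MeasureTheory.Measure ℝ} (h : IsContMeasure m) (t : ℝ) :
    IsContMeasure (m.map (fun s => s - t)) := by
  obtain ⟨h1, h2, h3⟩ := h
  have hr : (m.map (fun s => s - t)).Regular :=
    MeasureTheory.Measure.Regular.map (Homeomorph.subRight t)
  refine ⟨inferInstance, hr, ⟨fun x => ?_⟩⟩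
  rw [MeasureTheory.Measure.map_apply (by fun_prop) (measurableSet_singleton x)]
  have : (fun s : ℝ => s - t) ⁻¹' {x} = {x + t} := by
    ext s
    simp [sub_eq_iff_eq_add]
  rw [this]
  exact h3.measure_singleton _

/-- A non-decreasing family of moduli of continuity `ω_j : [0, ∞) → [0, ∞)`, `j ≥ 1`. -/
structure IsModuliFamily (ω : ℕ+ → ℝ≥0 → ℝ≥0) : Prop where
  continuous : ∀ j, Continuous (ω j)
  monotone : ∀ j, Monotone (ω j)
  zero : ∀ j, ω j 0 = 0
  le_succ : ∀ j r, ω j r ≤ ω (j + 1) r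

section Bounds

variable {N : ℕ}

/-- `m` is an `m`-bound on the closed ball `B_j` of the family `(ν_y)` of b-measures. -/
def IsMBound (ν : EuclideanSpace ℝ (Fin N) → BMeasure) (j : ℕ+)
    (m : MeasureTheory.Measure ℝ) : Prop :=
  IsContMeasure m ∧ ∀ A, IsBoundedBorel A → ∀ y, ‖y‖ ≤ (j : ℝ) → (ν y).totalVar A ≤ m A

/-- `l` is an `l`-bound on the closed ball `B_j` of the family `(ν_y)` of b-measures, with respect
to the moduli of continuity `ω`. -/
def IsLBound (ω : ℕ+ → ℝ≥0 → ℝ≥0) (ν : EuclideanSpace ℝ (Fin N) → BMeasure) (j : ℕ+)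
    (l : MeasureTheory.Measure ℝ) : Prop :=
  IsContMeasure l ∧ ∀ A, IsBoundedBorel A → ∀ y₁ y₂, ‖y₁‖ ≤ (j : ℝ) → ‖y₂‖ ≤ (j : ℝ) →
    (ν y₁ - ν y₂).totalVar A ≤ l A * (ω j ‖y₁ - y₂‖₊ : ℝ≥0∞)

end Bounds

/-- The vector space `𝔐_p` of parametric b-measures on `ℝ^N` with respect to the family of moduli
of continuity `ω`: the maps from `ℝ^N` to the b-measures that have an `m`-bound and an `l`-bound on
each closed ball `B_j`, `j ≥ 1`. -/
def ParamBMeasure (N : ℕ) (ω : ℕ+ → ℝ≥0 → ℝ≥0) :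
    Submodule ℝ (EuclideanSpace ℝ (Fin N) → BMeasure) where
  carrier := {ν | ∀ j, (∃ m, IsMBound ν j m) ∧ ∃ l, IsLBound ω ν j l}
  zero_mem' j := by
    refine ⟨⟨0, isContMeasure_zero, fun A _ y _ => ?_⟩,
      ⟨0, isContMeasure_zero, fun A _ y₁ y₂ _ _ => ?_⟩⟩
    · simp [BMeasure.totalVar_zero]
    · simp [BMeasure.totalVar_zero]
  add_mem' {ν ν'} h h' j := by
    obtain ⟨⟨m, hm, hm'⟩, l, hl, hl'⟩ := h j
    obtain ⟨⟨p, hp, hp'⟩, q, hq, hq'⟩ := h' j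
    refine ⟨⟨m + p, hm.add hp, fun A hA y hy => ?_⟩, l + q, hl.add hq,
      fun A hA y₁ y₂ h₁ h₂ => ?_⟩
    · exact (BMeasure.totalVar_add_le _ _ _).trans (add_le_add (hm' A hA y hy) (hp' A hA y hy))
    · have e : (ν + ν') y₁ - (ν + ν') y₂ = (ν y₁ - ν y₂) + (ν' y₁ - ν' y₂) := by
        simp only [Pi.add_apply]
        abel
      rw [e, MeasureTheory.Measure.add_apply, add_mul]
      exact (BMeasure.totalVar_add_le _ _ _).trans
        (add_le_add (hl' A hA y₁ y₂ h₁ h₂) (hq' A hA y₁ y₂ h₁ h₂))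
  smul_mem' c ν h j := by
    obtain ⟨⟨m, hm, hm'⟩, l, hl, hl'⟩ := h j
    refine ⟨⟨‖c‖₊ • m, hm.smul _, fun A hA y hy => ?_⟩, ‖c‖₊ • l, hl.smul _,
      fun A hA y₁ y₂ h₁ h₂ => ?_⟩
    · refine (BMeasure.totalVar_smul_le c (ν y) A).trans ?_
      exact mul_le_mul_right (hm' A hA y hy) _
    · have e : (c • ν) y₁ - (c • ν) y₂ = c • (ν y₁ - ν y₂) := by
        simp [smul_sub]
      rw [e]
      refine (BMeasure.totalVar_smul_le c _ A).trans ?_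
      refine (mul_le_mul_right (hl' A hA y₁ y₂ h₁ h₂) _).trans (le_of_eq ?_)
      rw [← mul_assoc]
      rfl

section Spaces

variable {N : ℕ} {ω : ℕ+ → ℝ≥0 → ℝ≥0}

/-- The translate `ν·t` of a parametric b-measure, `(ν·t)_y = ν_y·t`. -/
def ParamBMeasure.translate (ν : ParamBMeasure N ω) (t : ℝ) : ParamBMeasure N ω :=
  ⟨fun y => (ν.1 y).translate t, by
    have key : ∀ A : Set ℝ, IsBoundedBorel A →
        IsBoundedBorel ((fun s => s + t) '' A) ∧ ∀ m : MeasureTheory.Measure ℝ,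
          m.map (fun s => s - t) A = m ((fun s => s + t) '' A) := by
      intro A hA
      refine ⟨⟨(MeasurableEquiv.addRight t).measurableSet_image.2 hA.1,
        (isometry_add_right t).lipschitz.isBounded_image hA.2⟩, fun m => ?_⟩
      rw [MeasureTheory.Measure.map_apply (by fun_prop) hA.1]
      congr 1
      ext s
      simp [sub_eq_add_neg]
    intro j
    obtain ⟨⟨m, hm, hm'⟩, l, hl, hl'⟩ := ν.2 j
    refine ⟨⟨_, hm.map_sub t, fun A hA y hy => ?_⟩, _, hl.map_sub t,
      fun A hA y₁ y₂ h₁ h₂ => ?_⟩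
    · rw [(key A hA).2]
      exact (BMeasure.totalVar_translate_le _ t A).trans (hm' _ (key A hA).1 y hy)
    · rw [(key A hA).2]
      exact (BMeasure.totalVar_translate_le (ν.1 y₁ - ν.1 y₂) t A).trans
        (hl' _ (key A hA).1 y₁ y₂ h₁ h₂)⟩

/-- The points `t 0 < t 1 < ⋯ < t n` and the tags `τ i ∈ [t i, t (i + 1)]`, `i < n`, form a tagged
`δ`-partition of `[a, b]`.  (The other values of `t` and `τ` play no role.) -/
structure IsTaggedPartition (a b δ : ℝ) (n : ℕ) (t τ : ℕ → ℝ) : Prop where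
  left : t 0 = a
  right : t n = b
  lt : ∀ i < n, t i < t (i + 1)
  tag : ∀ i < n, τ i ∈ Icc (t i) (t (i + 1))
  mesh : ∀ i < n, t (i + 1) - t i < δ

/-- `L` is the integral `∫_a^b dν_{y(s)}` of `ν` along the curve `y : [a, b] → ℝ^N`, that is, the
limit of the Riemann sums over tagged partitions.  Only the values of `y` on `[a, b]` matter. -/
def HasParamIntegral (ν : ParamBMeasure N ω) (a b : ℝ) (y : ℝ → EuclideanSpace ℝ (Fin N))
    (L : ℝ) : Prop :=
  ∀ ε > 0, ∃ δ > 0, ∀ (n : ℕ) (t τ : ℕ → ℝ), IsTaggedPartition a b δ n t τ →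
    |L - ∑ i ∈ Finset.range n, ν.1 (y (τ i)) (Icc (t i) (t (i + 1)))| < ε

open Classical in
/-- The integral `∫_a^b dν_{y(s)}`; it exists, and is unique, for every continuous `y` and `a < b`.
(If there is no such integral, the value is `0` by convention.) -/
noncomputable def paramIntegral (ν : ParamBMeasure N ω) (a b : ℝ)
    (y : ℝ → EuclideanSpace ℝ (Fin N)) : ℝ :=
  if h : ∃ L, HasParamIntegral ν a b y L then h.choose else 0

/-- A suitable set of moduli of continuity `θ_j^I`, `j ≥ 1`, `I = [q₁, q₂]` with rational
`q₁ < q₂`; here `θ j q₁ q₂` stands for `θ_j^I` (its values for `q₂ ≤ q₁` play no role). -/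
structure IsSuitable (θ : ℕ+ → ℚ → ℚ → ℝ≥0 → ℝ≥0) : Prop where
  continuous : ∀ j q₁ q₂, q₁ < q₂ → Continuous (θ j q₁ q₂)
  monotone : ∀ j q₁ q₂, q₁ < q₂ → Monotone (θ j q₁ q₂)
  zero : ∀ j q₁ q₂, q₁ < q₂ → θ j q₁ q₂ 0 = 0
  le : ∀ j k q₁ q₂ p₁ p₂, j ≤ k → q₁ < q₂ → p₁ < p₂ → p₁ ≤ q₁ → q₂ ≤ p₂ →
    ∀ r, θ j q₁ q₂ r ≤ θ k p₁ p₂ r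

/-- The set `𝓚_j^I`, `I = [q₁, q₂]`, of continuous curves `I → B_j` that admit `θ_j^I` as a modulus
of continuity.  Curves are represented by maps on `ℝ`, whose values outside `I` play no role. -/
def curveSet (N : ℕ) (θ : ℕ+ → ℚ → ℚ → ℝ≥0 → ℝ≥0) (j : ℕ+) (q₁ q₂ : ℚ) :
    Set (ℝ → EuclideanSpace ℝ (Fin N)) :=
  {y | ContinuousOn y (Icc (q₁ : ℝ) q₂) ∧ (∀ s ∈ Icc (q₁ : ℝ) q₂, ‖y s‖ ≤ (j : ℝ)) ∧
    ∀ s ∈ Icc (q₁ : ℝ) q₂, ∀ t ∈ Icc (q₁ : ℝ) q₂, ‖y s - y t‖₊ ≤ θ j q₁ q₂ ‖s - t‖₊}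

/-- The seminorm `p_{I,j}(ν) = sup_{y ∈ 𝓚_j^I} |∫_I dν_{y(s)}|`, `I = [q₁, q₂]`, as an extended
non-negative number (it is always finite). -/
noncomputable def seminormTheta (θ : ℕ+ → ℚ → ℚ → ℝ≥0 → ℝ≥0) (j : ℕ+) (q₁ q₂ : ℚ)
    (ν : ParamBMeasure N ω) : ℝ≥0∞ :=
  ⨆ y ∈ curveSet N θ j q₁ q₂, ENNReal.ofReal |paramIntegral ν q₁ q₂ y|

/-- The topology `σ_Θ`, generated by the seminorms `p_{I,j}`: the coarsest topology for which all
the balls of all these seminorms are open. -/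
def sigmaTheta (N : ℕ) (ω : ℕ+ → ℝ≥0 → ℝ≥0) (θ : ℕ+ → ℚ → ℚ → ℝ≥0 → ℝ≥0) :
    TopologicalSpace (ParamBMeasure N ω) :=
  TopologicalSpace.generateFrom
    {U | ∃ (j : ℕ+) (q₁ q₂ : ℚ) (ν : ParamBMeasure N ω) (r : ℝ), q₁ < q₂ ∧ 0 < r ∧
      U = {μ | seminormTheta θ j q₁ q₂ (μ - ν) < ENNReal.ofReal r}}

/-- The seminorm `p_{I,y}(ν) = |∫_I dν_y| = |ν_y(I)|`, `I = [q₁, q₂]`. -/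
def seminormD (y : EuclideanSpace ℝ (Fin N)) (q₁ q₂ : ℚ) (ν : ParamBMeasure N ω) : ℝ :=
  |ν.1 y (Icc (q₁ : ℝ) q₂)|

/-- The topology `σ_D`, generated by the seminorms `p_{I,y}` with `y ∈ D`. -/
def sigmaD (N : ℕ) (ω : ℕ+ → ℝ≥0 → ℝ≥0) (D : Set (EuclideanSpace ℝ (Fin N))) :
    TopologicalSpace (ParamBMeasure N ω) :=
  TopologicalSpace.generateFrom
    {U | ∃ y ∈ D, ∃ (q₁ q₂ : ℚ) (ν : ParamBMeasure N ω) (r : ℝ), q₁ < q₂ ∧ 0 < r ∧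
      U = {μ | seminormD y q₁ q₂ (μ - ν) < r}}

/-- A family of positive measures is bounded. -/
def BoundedMeasures {Γ : Type*} (μ : Γ → MeasureTheory.Measure ℝ) : Prop :=
  ∃ c : ℝ, 0 < c ∧ ∀ t : ℝ, ∀ α, μ α (Icc t (t + 1)) ≤ ENNReal.ofReal c

/-- A family of positive measures is equicontinuous. -/
def EquicontinuousMeasures {Γ : Type*} (μ : Γ → MeasureTheory.Measure ℝ) : Prop :=
  ∀ ε : ℝ, 0 < ε → ∃ δ : ℝ, 0 < δ ∧ ∀ s t : ℝ, 0 ≤ t - s → t - s < δ → ∀ α,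
    μ α (Icc s t) < ENNReal.ofReal ε

/-- The family `(ν_α)` of parametric b-measures has equicontinuous `m`-bounds. -/
def FamilyEquicontMBounds {Γ : Type*} (ν : Γ → ParamBMeasure N ω) : Prop :=
  ∃ m : ℕ+ → Γ → MeasureTheory.Measure ℝ,
    ∀ j, (∀ α, IsMBound (ν α).1 j (m j α)) ∧ EquicontinuousMeasures (m j)

/-- The family `(ν_α)` of parametric b-measures has bounded `l`-bounds. -/
def FamilyBoundedLBounds {Γ : Type*} (ν : Γ → ParamBMeasure N ω) : Prop :=
  ∃ l : ℕ+ → Γ → MeasureTheory.Measure ℝ,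
    ∀ j, (∀ α, IsLBound ω (ν α).1 j (l j α)) ∧ BoundedMeasures (l j)

/-- `ν` has equicontinuous `m`-bounds: the family of its translates does. -/
def HasEquicontMBounds (ν : ParamBMeasure N ω) : Prop :=
  FamilyEquicontMBounds (fun t : ℝ => ParamBMeasure.translate ν t)

/-- `ν` has bounded `l`-bounds: the family of its translates does. -/
def HasBoundedLBounds (ν : ParamBMeasure N ω) : Prop :=
  FamilyBoundedLBounds (fun t : ℝ => ParamBMeasure.translate ν t)

/-- The hull of `ν`: the closure of the set of its translates in the given topology of the space of
parametric b-measures. -/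
def hull [TopologicalSpace (ParamBMeasure N ω)] (ν : ParamBMeasure N ω) :
    Set (ParamBMeasure N ω) :=
  closure (range fun t : ℝ => ParamBMeasure.translate ν t)

end Spaces

/-! A b-measure does not charge points, so it is handled through its distribution function
`BMeasure.cdf`, and integrals are handled through Riemann sums over half-open Borel partitions. Two
such sums are compared piece by piece on the common refinement, where the l-bound controls the
change of parameter (`IsBorelPartition.abs_sum_sub_sum_le`).

Flow: equicontinuous m-bounds make the distribution functions of all translates equicontinuous,
uniformly for parameters in a ball. Evaluations on rational intervals are continuous in both
topologies (for `σ_D`, at parameters in `D`), so the same estimate holds on the whole hull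
(`abs_cdf_sub_le_of_mem_closure`). Hence a small change of time moves the endpoints of an interval
at a uniformly small cost, which gives joint continuity for `σ_D`. For `σ_Θ`, the integral of a
translate is rewritten as an integral over a fixed larger rational interval, along the curve shifted
and extended by constants, minus two tails with constant parameter (`paramIntegral_translate`).
Monotonicity of `Θ` in the interval keeps the extended curve admissible, and the tails are treated
as for `σ_D`.

Compactness: both topologies are regular, so it is enough to find limits of ultrafilters containing
the orbit. Along such an ultrafilter the distribution functions of the translates and of their
bounds converge pointwise. The limit of the m-bounds is continuous by equicontinuity. The limit of
the l-bounds is only monotone and may jump, but its atoms can be discarded because b-measures vanish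
on countable sets (`BMeasure.totalVar_le_contPart`). So the limit is again a parametric b-measure
(`exists_paramBMeasure`). Convergence on intervals already gives `σ_D`-convergence. For `σ_Θ`, the
bounded l-bounds, the compactness of balls and the common modulus of the curves make it uniform
(`tendsto_sigmaTheta_of_tendsto_apply`). -/

section BoundedBorel

theorem isBoundedBorel_Ioc (a b : ℝ) : IsBoundedBorel (Ioc a b) :=
  ⟨measurableSet_Ioc, Metric.isBounded_Ioc a b⟩

theorem isBoundedBorel_Icc (a b : ℝ) : IsBoundedBorel (Icc a b) :=
  ⟨measurableSet_Icc, Metric.isBounded_Icc a b⟩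

theorem IsBoundedBorel.subset {A B : Set ℝ} (hB : IsBoundedBorel B) (hA : MeasurableSet A)
    (h : A ⊆ B) : IsBoundedBorel A :=
  ⟨hA, hB.2.subset h⟩

theorem IsBoundedBorel.measure_lt_top {A : Set ℝ} (hA : IsBoundedBorel A)
    (m : MeasureTheory.Measure ℝ) [MeasureTheory.IsLocallyFiniteMeasure m] : m A < ⊤ :=
  hA.2.measure_lt_top

end BoundedBorel

/-! ### Additivity, distribution functions and variation of b-measures. -/

namespace BMeasure

open MeasureTheory

theorem hasSum_iUnion (μ : BMeasure) {ι : Type*} [Countable ι] {A : ι → Set ℝ}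
    (hm : ∀ i, MeasurableSet (A i)) (hd : Pairwise (Function.onFun Disjoint A))
    (hb : IsBoundedBorel (⋃ i, A i)) : HasSum (fun i => μ (A i)) (μ (⋃ i, A i)) := by
  obtain ⟨e, he⟩ := Countable.exists_injective_nat ι
  rw [← hasSum_extend_zero he]
  have hU : ⋃ n, Function.extend e A (fun _ => ∅) n = ⋃ i, A i := iSup_extend_bot he _
  have hsub : ∀ n, Function.extend e A (fun _ => ∅) n ⊆ ⋃ i, A i := fun n => by
    rw [← hU]
    exact subset_iUnion _ n
  have hmeas : ∀ n, MeasurableSet (Function.extend e A (fun _ => ∅) n) := by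
    intro n
    by_cases hn : ∃ i, e i = n
    · obtain ⟨i, rfl⟩ := hn
      rw [he.extend_apply]
      exact hm i
    · rw [Function.extend_apply' _ _ _ hn]
      exact MeasurableSet.empty
  have key := μ.hasSum' (Function.extend e A (fun _ => ∅)) (fun n => hb.subset (hmeas n) (hsub n))
    (hd.disjoint_extend_bot (he.factorsThrough A)) (by rwa [hU])
  rw [hU] at key
  convert key using 2 with n
  by_cases hn : ∃ i, e i = n
  · obtain ⟨i, rfl⟩ := hn
    rw [he.extend_apply, he.extend_apply]
  · rw [Function.extend_apply' _ _ _ hn, Function.extend_apply' _ _ _ hn, μ.empty']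
    rfl

theorem sum_eq (μ : BMeasure) {ι : Type*} [Fintype ι] {A : ι → Set ℝ} {K : Set ℝ}
    (hm : ∀ i, MeasurableSet (A i)) (hd : Pairwise (Function.onFun Disjoint A))
    (hK : IsBoundedBorel K) (hU : ⋃ i, A i = K) : ∑ i, μ (A i) = μ K := by
  subst hU
  exact (hasSum_fintype _).unique (μ.hasSum_iUnion hm hd hK)

theorem union_eq (μ : BMeasure) {A B : Set ℝ} (hA : IsBoundedBorel A) (hB : IsBoundedBorel B)
    (hd : Disjoint A B) : μ (A ∪ B) = μ A + μ B := by
  have h := μ.sum_eq (ι := Bool) (A := fun b => cond b A B) (K := A ∪ B)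
    (by rintro (_ | _) <;> simp [hA.1, hB.1]) (pairwise_disjoint_on_bool.2 hd)
    ⟨hA.1.union hB.1, hA.2.union hB.2⟩ union_eq_iUnion.symm
  simpa using h.symm

/-- Countable additivity over the points of the set. This is what later allows the atoms of a
limiting l-bound to be dropped. -/
theorem eq_zero_of_countable (μ : BMeasure) {A : Set ℝ} (hA : IsBoundedBorel A)
    (hc : A.Countable) : μ A = 0 := by
  have := hc.to_subtype
  have hU : ⋃ x : A, ({(x : ℝ)} : Set ℝ) = A := by simp
  have h := μ.hasSum_iUnion (A := fun x : A => {(x : ℝ)}) (fun _ => measurableSet_singleton _)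
    (fun x y hxy => disjoint_singleton.2 fun h => hxy (Subtype.ext h))
    (by rwa [hU])
  rw [hU] at h
  simp only [μ.singleton'] at h
  exact h.unique hasSum_zero

theorem apply_Icc (μ : BMeasure) {a b : ℝ} (hab : a ≤ b) : μ (Icc a b) = μ (Ioc a b) := by
  rw [← Ioc_union_left hab, μ.union_eq (isBoundedBorel_Ioc a b)
    (by simpa using isBoundedBorel_Icc a a) (by simp), μ.singleton', add_zero]

/-- The distribution function of a b-measure, normalized to vanish at `0`. -/
def cdf (μ : BMeasure) (s : ℝ) : ℝ := μ (Ioc 0 s) - μ (Ioc s 0)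

theorem apply_Ioc_add (μ : BMeasure) {a b c : ℝ} (hab : a ≤ b) (hbc : b ≤ c) :
    μ (Ioc a b) + μ (Ioc b c) = μ (Ioc a c) := by
  rw [← μ.union_eq (isBoundedBorel_Ioc a b) (isBoundedBorel_Ioc b c), Ioc_union_Ioc_eq_Ioc hab hbc]
  exact Ioc_disjoint_Ioc_of_le le_rfl

theorem apply_Ioc (μ : BMeasure) {a b : ℝ} (hab : a ≤ b) :
    μ (Ioc a b) = μ.cdf b - μ.cdf a := by
  unfold cdf
  rcases le_total 0 a with ha | ha
  · rw [← μ.apply_Ioc_add ha hab, Ioc_eq_empty_of_le ha, Ioc_eq_empty_of_le (ha.trans hab)]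
    ring
  · rcases le_total 0 b with hb | hb
    · rw [← μ.apply_Ioc_add ha hb, Ioc_eq_empty_of_le ha, Ioc_eq_empty_of_le hb, μ.empty']
      ring
    · rw [← μ.apply_Ioc_add hab hb, Ioc_eq_empty_of_le hb, Ioc_eq_empty_of_le (hab.trans hb)]
      ring

theorem cdf_zero (μ : BMeasure) : μ.cdf 0 = 0 := by simp [cdf]

theorem cdf_sub (μ ν : BMeasure) (s : ℝ) : (μ - ν).cdf s = μ.cdf s - ν.cdf s := by
  have h : ∀ A, (μ - ν) A = μ A - ν A := fun _ => rfl
  simp only [cdf, h]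
  ring

theorem translate_Ioc (μ : BMeasure) (t a b : ℝ) :
    μ.translate t (Ioc a b) = μ (Ioc (a + t) (b + t)) := by
  change μ ((fun s => s + t) '' Ioc a b) = _
  rw [image_add_const_Ioc]

theorem ofReal_abs_le_totalVar (μ : BMeasure) {A : Set ℝ} (hA : MeasurableSet A) :
    ENNReal.ofReal |μ A| ≤ μ.totalVar A := by
  simpa using μ.sum_le_totalVar (n := 1) (fun _ => A) (fun _ => hA)
    (fun i j hij => absurd (Subsingleton.elim i j) hij) (iUnion_const A)

/-- Additivity of `m` over a partition turns a bound for the values into one for the variation, so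
partitions need not be handled again. -/
theorem totalVar_le_of_forall (μ : BMeasure) {m : Measure ℝ} {c : ℝ≥0∞}
    (h : ∀ A, IsBoundedBorel A → ENNReal.ofReal |μ A| ≤ m A * c) {A : Set ℝ}
    (hA : IsBoundedBorel A) : μ.totalVar A ≤ m A * c := by
  refine μ.totalVar_le fun n P h1 h2 h3 => ?_
  calc ∑ i, ENNReal.ofReal |μ (P i)| ≤ ∑ i, m (P i) * c :=
        Finset.sum_le_sum fun i _ => h _ (hA.subset (h1 i) (h3 ▸ subset_iUnion P i))
    _ = m A * c := by
        rw [← Finset.sum_mul, ← h3, measure_iUnion h2 h1, tsum_fintype]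

theorem abs_le_of_totalVar_le (μ : BMeasure) {A : Set ℝ} (hA : MeasurableSet A) {r : ℝ≥0∞}
    (h : μ.totalVar A ≤ r) (hr : r ≠ ⊤) : |μ A| ≤ r.toReal :=
  (ENNReal.ofReal_le_iff_le_toReal hr).1 ((μ.ofReal_abs_le_totalVar hA).trans h)

/-- The b-measure given by the difference of two locally finite measures without atoms. -/
noncomputable def ofDiff (α β : Measure ℝ) (hα : IsContMeasure α) (hβ : IsContMeasure β) :
    BMeasure where
  toFun A := by
    classical
    exact if IsBoundedBorel A then α.real A - β.real A else 0
  junk' A hA := by simp [hA]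
  empty' := by simp
  hasSum' A h1 h2 h3 := by
    have key : ∀ m : Measure ℝ, IsContMeasure m →
        HasSum (fun n => m.real (A n)) (m.real (⋃ n, A n)) := by
      intro m hm
      have := hm.1
      unfold Measure.real
      rw [measure_iUnion h2 fun n => (h1 n).1]
      have hne : ∑' n, m (A n) ≠ ⊤ := by
        rw [← measure_iUnion h2 fun n => (h1 n).1]
        exact (h3.measure_lt_top m).ne
      rw [ENNReal.tsum_toReal_eq fun n => ENNReal.ne_top_of_tsum_ne_top hne n]
      exact ENNReal.hasSum_toReal hne
    simp only [h1, h3, if_true]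
    exact (key α hα).sub (key β hβ)
  singleton' t := by
    have h1 := hα.2.2.measure_singleton t
    have h2 := hβ.2.2.measure_singleton t
    simp [Measure.real, h1, h2]

theorem ofDiff_apply {α β : Measure ℝ} (hα : IsContMeasure α) (hβ : IsContMeasure β) {A : Set ℝ}
    (hA : IsBoundedBorel A) : ofDiff α β hα hβ A = α.real A - β.real A :=
  if_pos hA

end BMeasure

/-! ### Comparison of Stieltjes measures. -/

section Stieltjes

open MeasureTheory

theorem StieltjesFunction.measure_le_of_monotone_sub (f g : StieltjesFunction ℝ)
    (h : Monotone fun x => g x - f x) : f.measure ≤ g.measure := by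
  let k : StieltjesFunction ℝ := ⟨fun x => g x - f x, h,
    fun x => (g.right_continuous x).sub (f.right_continuous x)⟩
  have e : g = f + k := by
    ext x
    simp [k]
  rw [e, StieltjesFunction.measure_add]
  exact Measure.le_add_right le_rfl

theorem StieltjesFunction.isContMeasure (f : StieltjesFunction ℝ) (hf : Continuous f) :
    IsContMeasure f.measure := by
  refine ⟨inferInstance, inferInstance, ⟨fun x => ?_⟩⟩
  rw [StieltjesFunction.measure_singleton, hf.continuousWithinAt.leftLim_eq]
  simp

/-- The hypothesis says that `g + k - f` and `f + k - g` are monotone, which gives inequalities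
between measures. Thus an estimate on intervals extends to all bounded Borel sets. -/
theorem StieltjesFunction.abs_real_sub_le (f g k : StieltjesFunction ℝ)
    (h : ∀ s t, s ≤ t → |(f t - f s) - (g t - g s)| ≤ k t - k s) {A : Set ℝ}
    (hA : IsBoundedBorel A) : ENNReal.ofReal |f.measure.real A - g.measure.real A| ≤ k.measure A := by
  have key : ∀ f g : StieltjesFunction ℝ,
      (∀ s t, s ≤ t → |(f t - f s) - (g t - g s)| ≤ k t - k s) →
      f.measure.real A ≤ g.measure.real A + k.measure.real A := by
    intro f g h
    have h1 : f.measure ≤ (g + k).measure := by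
      refine f.measure_le_of_monotone_sub _ fun s t hst => ?_
      have := (abs_le.1 (h s t hst)).2
      simp only [StieltjesFunction.add_apply]
      linarith
    have h2 := ENNReal.toReal_mono (hA.measure_lt_top _).ne (h1 A)
    rwa [StieltjesFunction.measure_add, Measure.add_apply, ENNReal.toReal_add
      (hA.measure_lt_top _).ne (hA.measure_lt_top _).ne] at h2
  rw [ENNReal.ofReal_le_iff_le_toReal (hA.measure_lt_top _).ne, abs_le]
  have h1 := key f g h
  have h2 := key g f fun s t hst => by
    rw [abs_sub_comm]
    exact h s t hst
  change -k.measure.real A ≤ _ ∧ _ ≤ k.measure.real A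
  constructor <;> linarith

end Stieltjes

/-! ### Borel partitions and Riemann sums. -/

section Partition

open MeasureTheory

/-- The sets `A i` form a partition of `K` into Borel sets. -/
structure IsBorelPartition {ι : Type*} (K : Set ℝ) (A : ι → Set ℝ) : Prop where
  measurableSet : ∀ i, MeasurableSet (A i)
  disjoint : Pairwise (Function.onFun Disjoint A)
  iUnion : ⋃ i, A i = K

namespace IsBorelPartition

variable {ι κ : Type*} {K : Set ℝ} {A : ι → Set ℝ} {B : κ → Set ℝ}

theorem subset (hA : IsBorelPartition K A) (i : ι) : A i ⊆ K :=
  hA.iUnion ▸ subset_iUnion A i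

theorem isBoundedBorel (hA : IsBorelPartition K A) (hK : IsBoundedBorel K) (i : ι) :
    IsBoundedBorel (A i) :=
  hK.subset (hA.measurableSet i) (hA.subset i)

theorem inter (hB : IsBorelPartition K B) {S : Set ℝ} (hS : MeasurableSet S) (hSK : S ⊆ K) :
    IsBorelPartition S (fun k => S ∩ B k) where
  measurableSet k := hS.inter (hB.measurableSet k)
  disjoint _ _ h := (hB.disjoint h).mono inter_subset_right inter_subset_right
  iUnion := by rw [← inter_iUnion, hB.iUnion, inter_eq_left.2 hSK]

theorem sum_eq [Fintype ι] (hA : IsBorelPartition K A) (hK : IsBoundedBorel K) (μ : BMeasure) :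
    ∑ i, μ (A i) = μ K :=
  μ.sum_eq hA.measurableSet hA.disjoint hK hA.iUnion

theorem sum_real_eq [Fintype ι] (hA : IsBorelPartition K A) (hK : IsBoundedBorel K)
    (l : Measure ℝ) [IsLocallyFiniteMeasure l] : ∑ i, l.real (A i) = l.real K := by
  have h := measure_iUnion hA.disjoint hA.measurableSet (μ := l)
  rw [hA.iUnion, tsum_fintype] at h
  simp only [Measure.real]
  rw [h, ENNReal.toReal_sum fun i _ => ((hA.isBoundedBorel hK i).measure_lt_top l).ne]

/-- Both sums are split over the common refinement `A i ∩ B k` and compared termwise. In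
applications, a point of a nonempty piece links the two parameters `x i` and `z k`. -/
theorem abs_sum_sub_sum_le [Fintype ι] [Fintype κ] {E : Type*} (ν : E → BMeasure)
    (hA : IsBorelPartition K A) (hB : IsBorelPartition K B) (hK : IsBoundedBorel K)
    (l : Measure ℝ) [IsLocallyFiniteMeasure l] (c : ℝ) (x : ι → E) (z : κ → E)
    (h : ∀ i k, (A i ∩ B k).Nonempty →
      |ν (x i) (A i ∩ B k) - ν (z k) (A i ∩ B k)| ≤ l.real (A i ∩ B k) * c) :
    |∑ i, ν (x i) (A i) - ∑ k, ν (z k) (B k)| ≤ l.real K * c := by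
  have h1 : ∀ i, ν (x i) (A i) = ∑ k, ν (x i) (A i ∩ B k) := fun i =>
    ((hB.inter (hA.measurableSet i) (hA.subset i)).sum_eq (hA.isBoundedBorel hK i) _).symm
  have h2 : ∀ k, ν (z k) (B k) = ∑ i, ν (z k) (A i ∩ B k) := fun k => by
    simp only [inter_comm (A _)]
    exact ((hA.inter (hB.measurableSet k) (hB.subset k)).sum_eq (hB.isBoundedBorel hK k) _).symm
  have h3 : l.real K * c = ∑ i, ∑ k, l.real (A i ∩ B k) * c := by
    simp only [← Finset.sum_mul]
    rw [← hA.sum_real_eq hK l]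
    congr 1
    exact Finset.sum_congr rfl fun i _ =>
      ((hB.inter (hA.measurableSet i) (hA.subset i)).sum_real_eq (hA.isBoundedBorel hK i) l).symm
  simp only [h1, h2]
  rw [Finset.sum_comm (s := (Finset.univ : Finset κ)), ← Finset.sum_sub_distrib, h3]
  refine (Finset.abs_sum_le_sum_abs _ _).trans (Finset.sum_le_sum fun i _ => ?_)
  rw [← Finset.sum_sub_distrib]
  refine (Finset.abs_sum_le_sum_abs _ _).trans (Finset.sum_le_sum fun k _ => ?_)
  rcases (A i ∩ B k).eq_empty_or_nonempty with h0 | h0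
  · simp [h0, (ν _).empty']
  · exact h i k h0

end IsBorelPartition

theorem IsTaggedPartition.isBorelPartition {a b δ : ℝ} {n : ℕ} {t τ : ℕ → ℝ}
    (h : IsTaggedPartition a b δ n t τ) :
    IsBorelPartition (Ioc a b) (fun i : Fin n => Ioc (t i) (t (i + 1))) := by
  -- Only `t 0, …, t n` are constrained; freezing the sequence after `n` makes it monotone.
  have hmono : Monotone fun i => t (min i n) := by
    refine monotone_nat_of_le_succ fun i => ?_
    rcases lt_or_ge i n with hi | hi
    · rw [min_eq_left hi.le, min_eq_left (Nat.succ_le_of_lt hi)]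
      exact (h.lt i hi).le
    · rw [min_eq_right hi, min_eq_right (hi.trans (Nat.le_succ i))]
  have e : ∀ i : Fin n, Ioc (t i) (t (i + 1)) = Ioc (t (min i n)) (t (min (i + 1) n)) := fun i => by
    rw [min_eq_left i.2.le, min_eq_left (Nat.succ_le_of_lt i.2)]
  refine ⟨fun _ => measurableSet_Ioc, fun i k hik => ?_, ?_⟩
  · simp only [Function.onFun]
    rw [e, e]
    exact hmono.pairwise_disjoint_on_Ioc_succ (fun hv => hik (Fin.ext hv))
  · simp only [e]
    have := hmono.biUnion_Ico_Ioc_map_succ 0 n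
    simp only [min_self, zero_le, min_eq_left, h.left, h.right] at this
    rw [← this]
    ext s
    simp only [mem_iUnion, mem_Ico, zero_le, true_and, exists_prop]
    exact ⟨fun ⟨i, hi⟩ => ⟨i, i.2, hi⟩, fun ⟨i, hi, hs⟩ => ⟨⟨i, hi⟩, hs⟩⟩

theorem IsTaggedPartition.mono {a b δ δ' : ℝ} {n : ℕ} {t τ : ℕ → ℝ}
    (h : IsTaggedPartition a b δ n t τ) (hδ : δ ≤ δ') : IsTaggedPartition a b δ' n t τ :=
  ⟨h.left, h.right, h.lt, h.tag, fun i hi => (h.mesh i hi).trans_le hδ⟩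

theorem IsTaggedPartition.mem_Icc {a b δ : ℝ} {n : ℕ} {t τ : ℕ → ℝ}
    (h : IsTaggedPartition a b δ n t τ) {i : ℕ} (hi : i < n) : τ i ∈ Icc a b := by
  have hs := h.isBorelPartition.subset ⟨i, hi⟩
  rw [Ioc_subset_Ioc_iff (h.lt i hi)] at hs
  exact ⟨hs.2.trans (h.tag i hi).1, (h.tag i hi).2.trans hs.1⟩

theorem IsTaggedPartition.sum_eq {a b δ : ℝ} {n : ℕ} {t τ : ℕ → ℝ}
    (h : IsTaggedPartition a b δ n t τ) {E : Type*} (ν : E → BMeasure) (y : ℝ → E) :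
    ∑ i ∈ Finset.range n, ν (y (τ i)) (Icc (t i) (t (i + 1))) =
      ∑ i : Fin n, ν (y (τ i)) (Ioc (t i) (t (i + 1))) := by
  rw [Finset.sum_range]
  exact Finset.sum_congr rfl fun i _ => BMeasure.apply_Icc _ (h.lt i i.2).le

theorem exists_isTaggedPartition {a b δ : ℝ} (hab : a < b) (hδ : 0 < δ) :
    ∃ n t τ, IsTaggedPartition a b δ n t τ := by
  obtain ⟨n, hn⟩ := exists_nat_gt ((b - a) / δ)
  have hn0 : (0 : ℝ) < n := (div_pos (sub_pos.2 hab) hδ).trans hn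
  have hstep : ∀ i : ℕ, a + ((i + 1 : ℕ) : ℝ) * ((b - a) / n) - (a + i * ((b - a) / n)) =
      (b - a) / n := fun i => by
    push_cast
    ring
  have hpos : 0 < (b - a) / n := div_pos (sub_pos.2 hab) hn0
  refine ⟨n, fun i => a + i * ((b - a) / n), fun i => a + i * ((b - a) / n), by simp, ?_,
    fun i _ => ?_, fun i _ => ⟨le_rfl, ?_⟩, fun i _ => ?_⟩
  · field_simp
    ring
  · linarith [hstep i]
  · linarith [hstep i]
  · rw [hstep, div_lt_iff₀ hn0]
    rwa [div_lt_iff₀ hδ, mul_comm] at hn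

end Partition

/-! ### The integral along continuous curves. -/

section Integral

open MeasureTheory

variable {N : ℕ} {ω : ℕ+ → ℝ≥0 → ℝ≥0}

theorem IsLBound.abs_sub_le (hω : IsModuliFamily ω) {ν : EuclideanSpace ℝ (Fin N) → BMeasure}
    {j : ℕ+} {l : Measure ℝ} (hl : IsLBound ω ν j l) {A : Set ℝ} (hA : IsBoundedBorel A)
    {x z : EuclideanSpace ℝ (Fin N)} (hx : ‖x‖ ≤ (j : ℝ)) (hz : ‖z‖ ≤ (j : ℝ)) {η : ℝ≥0}
    (h : ‖x - z‖ ≤ η) : |ν x A - ν z A| ≤ l.real A * ω j η := by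
  have := hl.1.1
  have hne : l A * (ω j ‖x - z‖₊ : ℝ≥0∞) ≠ ⊤ :=
    ENNReal.mul_ne_top (hA.measure_lt_top l).ne ENNReal.coe_ne_top
  have h1 := (ν x - ν z).abs_le_of_totalVar_le hA.1 (hl.2 A hA x z hx hz) hne
  rw [ENNReal.toReal_mul, ENNReal.coe_toReal] at h1
  refine h1.trans (mul_le_mul_of_nonneg_left ?_ measureReal_nonneg)
  exact_mod_cast hω.monotone j (show ‖x - z‖₊ ≤ η from h)

/-- Right continuity of the modulus at `r`. With `r = 0` it makes an l-bound estimate small; for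
general `r` it absorbs an additional discretization error. -/
theorem IsModuliFamily.exists_mul_lt (hω : IsModuliFamily ω) (j : ℕ+) (C : ℝ) (r : ℝ≥0) {ε : ℝ}
    (hε : 0 < ε) : ∃ η : ℝ≥0, 0 < η ∧ ∀ η' ≤ η, C * ω j (r + η') < C * ω j r + ε := by
  have hc : Continuous fun η : ℝ≥0 => C * (ω j (r + η) : ℝ) :=
    continuous_const.mul (NNReal.continuous_coe.comp
      ((hω.continuous j).comp (continuous_const.add continuous_id)))
  have h0 : C * (ω j (r + 0) : ℝ) < C * ω j r + ε := by
    rw [add_zero]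
    linarith
  obtain ⟨η, hη, hη'⟩ := Metric.eventually_nhds_iff.1 ((hc.tendsto 0).eventually_lt_const h0)
  refine ⟨⟨η / 2, by positivity⟩, by exact half_pos hη, fun η' h => hη' ?_⟩
  rw [NNReal.dist_eq, NNReal.coe_zero, sub_zero, NNReal.abs_eq]
  exact lt_of_le_of_lt (show (η' : ℝ) ≤ η / 2 from h) (half_lt_self hη)

variable {ν : ParamBMeasure N ω} {a b : ℝ} {y : ℝ → EuclideanSpace ℝ (Fin N)} {j : ℕ+}

theorem exists_modulus (hy : ContinuousOn y (Icc a b)) {η : ℝ≥0} (hη : 0 < η) :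
    ∃ δ > 0, ∀ s ∈ Icc a b, ∀ t ∈ Icc a b, |s - t| < δ → ‖y s - y t‖ ≤ η := by
  obtain ⟨δ, hδ, h⟩ := Metric.uniformContinuousOn_iff_le.1
    (isCompact_Icc.uniformContinuousOn_of_continuous hy) η hη
  refine ⟨δ, hδ, fun s hs t ht hst => ?_⟩
  rw [← dist_eq_norm]
  exact h s hs t ht (by rw [Real.dist_eq]; exact hst.le)

theorem exists_riemannSum_close (hω : IsModuliFamily ω) (hy : ContinuousOn y (Icc a b))
    (hyj : ∀ s ∈ Icc a b, ‖y s‖ ≤ (j : ℝ)) {ε : ℝ} (hε : 0 < ε) :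
    ∃ δ > 0, ∀ n t τ n' t' τ', IsTaggedPartition a b δ n t τ → IsTaggedPartition a b δ n' t' τ' →
      |∑ i ∈ Finset.range n, ν.1 (y (τ i)) (Icc (t i) (t (i + 1))) -
        ∑ i ∈ Finset.range n', ν.1 (y (τ' i)) (Icc (t' i) (t' (i + 1)))| < ε := by
  obtain ⟨-, l, hl⟩ := ν.2 j
  have := hl.1.1
  obtain ⟨η, hη, hη'⟩ := hω.exists_mul_lt j (l.real (Ioc a b)) 0 hε
  obtain ⟨δ, hδ, h⟩ := exists_modulus hy hη
  -- Tags of two intersecting intervals are less than two mesh sizes apart.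
  refine ⟨δ / 2, half_pos hδ, fun n t τ n' t' τ' hP hQ => ?_⟩
  rw [hP.sum_eq ν.1 y, hQ.sum_eq ν.1 y]
  have hlt := hη' η le_rfl
  rw [zero_add, hω.zero j, NNReal.coe_zero, mul_zero, zero_add] at hlt
  refine lt_of_le_of_lt (hP.isBorelPartition.abs_sum_sub_sum_le ν.1 hQ.isBorelPartition
    (isBoundedBorel_Ioc a b) l (ω j η) (fun i => y (τ i)) (fun k => y (τ' k)) ?_) hlt
  rintro i k ⟨s, hs1, hs2⟩
  refine hl.abs_sub_le hω ((isBoundedBorel_Ioc _ _).subset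
    (measurableSet_Ioc.inter measurableSet_Ioc) inter_subset_left)
    (hyj _ (hP.mem_Icc i.2)) (hyj _ (hQ.mem_Icc k.2)) (h _ (hP.mem_Icc i.2) _ (hQ.mem_Icc k.2) ?_)
  have h1 := hP.tag i i.2
  have h2 := hQ.tag k k.2
  have h3 := hP.mesh i i.2
  have h4 := hQ.mesh k k.2
  rw [abs_lt]
  constructor <;> linarith [h1.1, h1.2, h2.1, h2.2, hs1.1, hs1.2, hs2.1, hs2.2]

theorem hasParamIntegral_paramIntegral (hω : IsModuliFamily ω) (hab : a < b)
    (hy : ContinuousOn y (Icc a b)) (hyj : ∀ s ∈ Icc a b, ‖y s‖ ≤ (j : ℝ)) :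
    HasParamIntegral ν a b y (paramIntegral ν a b y) := by
  have hex : ∃ L, HasParamIntegral ν a b y L := by
    choose n t τ hP using fun k : ℕ => exists_isTaggedPartition hab (Nat.one_div_pos_of_nat (n := k) (α := ℝ))
    set S : ℕ → ℝ := fun k => ∑ i ∈ Finset.range (n k),
      ν.1 (y (τ k i)) (Icc (t k i) (t k (i + 1))) with hS
    have hfine : ∀ δ : ℝ, 0 < δ → ∃ K : ℕ, ∀ k ≥ K, IsTaggedPartition a b δ (n k) (t k) (τ k) := by
      intro δ hδ
      obtain ⟨K, hK⟩ := exists_nat_one_div_lt hδ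
      exact ⟨K, fun k hk => (hP k).mono ((Nat.one_div_le_one_div hk).trans hK.le)⟩
    have hC : CauchySeq S := by
      refine Metric.cauchySeq_iff.2 fun ε hε => ?_
      obtain ⟨δ, hδ, h⟩ := exists_riemannSum_close (ν := ν) hω hy hyj hε
      obtain ⟨K, hK⟩ := hfine δ hδ
      exact ⟨K, fun m hm k hk => h _ _ _ _ _ _ (hK m hm) (hK k hk)⟩
    obtain ⟨L, hL⟩ := cauchySeq_tendsto_of_complete hC
    refine ⟨L, fun ε hε => ?_⟩
    obtain ⟨δ, hδ, h⟩ := exists_riemannSum_close (ν := ν) hω hy hyj (half_pos hε)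
    refine ⟨δ, hδ, fun n' t' τ' hQ => ?_⟩
    obtain ⟨K, hK⟩ := hfine δ hδ
    obtain ⟨K', hK'⟩ := Metric.tendsto_atTop.1 hL (ε / 2) (half_pos hε)
    have h1 := h _ _ _ _ _ _ (hK (max K K') (le_max_left _ _)) hQ
    have h2 := hK' (max K K') (le_max_right _ _)
    rw [Real.dist_eq, abs_sub_comm] at h2
    refine (abs_sub_le _ (S (max K K')) _).trans_lt ?_
    linarith
  unfold paramIntegral
  rw [dif_pos hex]
  exact hex.choose_spec

theorem HasParamIntegral.unique (hab : a < b) {L L' : ℝ} (h : HasParamIntegral ν a b y L)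
    (h' : HasParamIntegral ν a b y L') : L = L' := by
  refine eq_of_abs_sub_le_all fun ε hε => ?_
  obtain ⟨δ, hδ, h1⟩ := h (ε / 2) (half_pos hε)
  obtain ⟨δ', hδ', h2⟩ := h' (ε / 2) (half_pos hε)
  obtain ⟨n, t, τ, hP⟩ := exists_isTaggedPartition hab (lt_min hδ hδ')
  have h3 := h1 n t τ (hP.mono (min_le_left _ _))
  have h4 := h2 n t τ (hP.mono (min_le_right _ _))
  rw [abs_sub_comm] at h4
  exact (abs_sub_le _ _ _).trans (by linarith)

theorem HasParamIntegral.add {ν' : ParamBMeasure N ω} {L L' : ℝ} (h : HasParamIntegral ν a b y L)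
    (h' : HasParamIntegral ν' a b y L') : HasParamIntegral (ν + ν') a b y (L + L') := by
  intro ε hε
  obtain ⟨δ, hδ, h1⟩ := h (ε / 2) (half_pos hε)
  obtain ⟨δ', hδ', h2⟩ := h' (ε / 2) (half_pos hε)
  refine ⟨min δ δ', lt_min hδ hδ', fun n t τ hP => ?_⟩
  have h3 := h1 n t τ (hP.mono (min_le_left _ _))
  have h4 := h2 n t τ (hP.mono (min_le_right _ _))
  have e : ∀ x A, (ν + ν').1 x A = ν.1 x A + ν'.1 x A := fun _ _ => rfl
  simp only [e, Finset.sum_add_distrib]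
  rw [add_sub_add_comm]
  exact (abs_add_le _ _).trans_lt (by linarith)

theorem HasParamIntegral.neg {L : ℝ} (h : HasParamIntegral ν a b y L) :
    HasParamIntegral (-ν) a b y (-L) := by
  intro ε hε
  obtain ⟨δ, hδ, h1⟩ := h ε hε
  refine ⟨δ, hδ, fun n t τ hP => ?_⟩
  have e : ∀ x A, (-ν).1 x A = -ν.1 x A := fun _ _ => rfl
  simp only [e, Finset.sum_neg_distrib]
  rw [← neg_sub', abs_neg]
  exact h1 n t τ hP

theorem paramIntegral_add (hω : IsModuliFamily ω) (hab : a < b) (ν ν' : ParamBMeasure N ω)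
    (hy : ContinuousOn y (Icc a b)) (hyj : ∀ s ∈ Icc a b, ‖y s‖ ≤ (j : ℝ)) :
    paramIntegral (ν + ν') a b y = paramIntegral ν a b y + paramIntegral ν' a b y :=
  (hasParamIntegral_paramIntegral hω hab hy hyj).unique hab
    ((hasParamIntegral_paramIntegral hω hab hy hyj).add
      (hasParamIntegral_paramIntegral hω hab hy hyj))

theorem paramIntegral_neg (hω : IsModuliFamily ω) (hab : a < b) (ν : ParamBMeasure N ω)
    (hy : ContinuousOn y (Icc a b)) (hyj : ∀ s ∈ Icc a b, ‖y s‖ ≤ (j : ℝ)) :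
    paramIntegral (-ν) a b y = -paramIntegral ν a b y :=
  (hasParamIntegral_paramIntegral hω hab hy hyj).unique hab
    (hasParamIntegral_paramIntegral hω hab hy hyj).neg

theorem paramIntegral_sub (hω : IsModuliFamily ω) (hab : a < b) (ν ν' : ParamBMeasure N ω)
    (hy : ContinuousOn y (Icc a b)) (hyj : ∀ s ∈ Icc a b, ‖y s‖ ≤ (j : ℝ)) :
    paramIntegral (ν - ν') a b y = paramIntegral ν a b y - paramIntegral ν' a b y := by
  rw [sub_eq_add_neg, paramIntegral_add hω hab _ _ hy hyj, paramIntegral_neg hω hab _ hy hyj,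
    sub_eq_add_neg]

theorem paramIntegral_const (hω : IsModuliFamily ω) (hab : a < b) (ν : ParamBMeasure N ω)
    {x : EuclideanSpace ℝ (Fin N)} (hx : ‖x‖ ≤ (j : ℝ)) :
    paramIntegral ν a b (fun _ => x) = ν.1 x (Ioc a b) := by
  refine (hasParamIntegral_paramIntegral hω hab continuousOn_const fun _ _ => hx).unique hab ?_
  refine fun ε hε => ⟨1, one_pos, fun n t τ hP => ?_⟩
  rw [hP.sum_eq ν.1 fun _ => x, hP.isBorelPartition.sum_eq (isBoundedBorel_Ioc a b), sub_self,
    abs_zero]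
  exact hε

/-- The integral is approximated by Riemann sums over arbitrarily fine Borel partitions. -/
theorem exists_partition_near (hω : IsModuliFamily ω) (hab : a < b)
    (hy : ContinuousOn y (Icc a b)) (hyj : ∀ s ∈ Icc a b, ‖y s‖ ≤ (j : ℝ)) {ε : ℝ} (hε : 0 < ε)
    {η : ℝ≥0} (hη : 0 < η) :
    ∃ (n : ℕ) (A : Fin n → Set ℝ) (τ : Fin n → ℝ), IsBorelPartition (Ioc a b) A ∧
      (∀ i, τ i ∈ Icc a b) ∧ (∀ i, ∀ s ∈ A i, ‖y s - y (τ i)‖ ≤ η) ∧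
      |paramIntegral ν a b y - ∑ i, ν.1 (y (τ i)) (A i)| < ε := by
  obtain ⟨δ, hδ, h⟩ := exists_modulus hy hη
  obtain ⟨δ', hδ', h'⟩ := hasParamIntegral_paramIntegral (ν := ν) hω hab hy hyj ε hε
  obtain ⟨n, t, τ, hP⟩ := exists_isTaggedPartition hab (lt_min hδ hδ')
  refine ⟨n, _, fun i => τ i, hP.isBorelPartition, fun i => hP.mem_Icc i.2, fun i s hs => ?_, ?_⟩
  · refine h _ (Ioc_subset_Icc_self (hP.isBorelPartition.subset i hs)) _ (hP.mem_Icc i.2) ?_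
    have h1 := hP.tag i i.2
    have h2 := (hP.mesh i i.2).trans_le (min_le_left _ _)
    rw [abs_lt]
    constructor <;> linarith [h1.1, h1.2, hs.1, hs.2]
  · rw [← hP.sum_eq ν.1 y]
    exact h' n t τ (hP.mono (min_le_right _ _))

/-- Comparison with a Riemann sum so fine that its error disappears in the limit. The pieces need
not be intervals and the parameters `x i` need not lie on the curve; the bound depends on the curve
only through `η`. -/
theorem abs_paramIntegral_sub_sum_le (hω : IsModuliFamily ω) (hab : a < b) {l : Measure ℝ}
    (hl : IsLBound ω ν.1 j l) (hy : ContinuousOn y (Icc a b))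
    (hyj : ∀ s ∈ Icc a b, ‖y s‖ ≤ (j : ℝ)) {ι : Type*} [Fintype ι] {A : ι → Set ℝ}
    (hA : IsBorelPartition (Ioc a b) A) {x : ι → EuclideanSpace ℝ (Fin N)}
    (hx : ∀ i, ‖x i‖ ≤ (j : ℝ)) {η : ℝ≥0} (h : ∀ i, ∀ s ∈ A i, ‖x i - y s‖ ≤ η) :
    |paramIntegral ν a b y - ∑ i, ν.1 (x i) (A i)| ≤ l.real (Ioc a b) * ω j η := by
  have := hl.1.1
  refine le_of_forall_pos_le_add fun ε hε => ?_
  obtain ⟨η', hη', h'⟩ := hω.exists_mul_lt j (l.real (Ioc a b)) η (half_pos hε)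
  obtain ⟨n, B, τ, hB, hτ, hBτ, hI⟩ :=
    exists_partition_near (ν := ν) hω hab hy hyj (half_pos hε) hη'
  have h1 := hA.abs_sum_sub_sum_le ν.1 hB (isBoundedBorel_Ioc a b) l (ω j (η + η')) x
    (fun k => y (τ k)) (by
      rintro i k ⟨s, hs1, hs2⟩
      refine hl.abs_sub_le hω ((isBoundedBorel_Ioc a b).subset
        ((hA.measurableSet i).inter (hB.measurableSet k)) (inter_subset_left.trans (hA.subset i)))
        (hx i) (hyj _ (hτ k)) ?_
      rw [NNReal.coe_add]
      exact (norm_sub_le_norm_sub_add_norm_sub _ (y s) _).trans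
        (add_le_add (h i s hs1) (hBτ k s hs2)))
  have h2 := h' η' le_rfl
  rw [abs_sub_comm] at h1
  refine (abs_sub_le _ (∑ k, ν.1 (y (τ k)) (B k)) _).trans ?_
  linarith

theorem abs_paramIntegral_sub_le (hω : IsModuliFamily ω) (hab : a < b) {l : Measure ℝ}
    (hl : IsLBound ω ν.1 j l) (hy : ContinuousOn y (Icc a b))
    (hyj : ∀ s ∈ Icc a b, ‖y s‖ ≤ (j : ℝ)) {z : ℝ → EuclideanSpace ℝ (Fin N)}
    (hz : ContinuousOn z (Icc a b)) (hzj : ∀ s ∈ Icc a b, ‖z s‖ ≤ (j : ℝ)) {η : ℝ≥0}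
    (h : ∀ s ∈ Icc a b, ‖z s - y s‖ ≤ η) :
    |paramIntegral ν a b y - paramIntegral ν a b z| ≤ l.real (Ioc a b) * ω j η := by
  refine le_of_forall_pos_le_add fun ε hε => ?_
  obtain ⟨η', hη', h'⟩ := hω.exists_mul_lt j (l.real (Ioc a b)) η (half_pos hε)
  obtain ⟨n, B, τ, hB, hτ, hBτ, hI⟩ :=
    exists_partition_near (ν := ν) hω hab hz hzj (half_pos hε) hη'
  have h1 := abs_paramIntegral_sub_sum_le (ν := ν) hω hab hl hy hyj hB (x := fun k => z (τ k))
    (fun k => hzj _ (hτ k)) (η := η + η') (fun k s hs => by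
      rw [NNReal.coe_add, add_comm (η : ℝ)]
      refine (norm_sub_le_norm_sub_add_norm_sub _ (z s) _).trans (add_le_add ?_ (h s ?_))
      · rw [norm_sub_rev]
        exact hBτ k s hs
      · exact Ioc_subset_Icc_self (hB.subset k hs))
  have h2 := h' η' le_rfl
  rw [abs_sub_comm] at hI
  refine (abs_sub_le _ (∑ k, ν.1 (z (τ k)) (B k)) _).trans ?_
  linarith

/-- The curve obtained from `y : [a, b] → ℝ^N` by a time shift and by extending it constantly to
the left and to the right. -/
def shiftExtend (a b t : ℝ) (y : ℝ → EuclideanSpace ℝ (Fin N)) : ℝ → EuclideanSpace ℝ (Fin N) :=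
  fun s => y (max a (min b (s - t)))

theorem clamp_mem_Icc (hab : a ≤ b) (s : ℝ) : max a (min b s) ∈ Icc a b :=
  ⟨le_max_left _ _, max_le hab (min_le_left _ _)⟩

theorem clamp_eq {s : ℝ} (hs : s ∈ Icc a b) : max a (min b s) = s := by
  rw [min_eq_right hs.2, max_eq_right hs.1]

theorem abs_clamp_sub_le (a b s t : ℝ) : |max a (min b s) - max a (min b t)| ≤ |s - t| := by
  refine (abs_max_sub_max_le_max _ _ _ _).trans ?_
  rw [sub_self, abs_zero, max_eq_right (abs_nonneg _)]
  refine (abs_min_sub_min_le_max _ _ _ _).trans ?_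
  rw [sub_self, abs_zero, max_eq_right (abs_nonneg _)]

theorem continuous_shiftExtend (hab : a ≤ b) (hy : ContinuousOn y (Icc a b)) (t : ℝ) :
    Continuous (shiftExtend a b t y) :=
  hy.comp_continuous (by fun_prop) fun s => clamp_mem_Icc hab _

/-- Moves the translation from the measure to the curve, so that nearby translates can be compared
over one interval `[p, q]`. On the two tails the extended curve is constant, so they contribute
plain values of `ν`. -/
theorem paramIntegral_translate (hω : IsModuliFamily ω) (hab : a < b)
    (hy : ContinuousOn y (Icc a b)) (hyj : ∀ s ∈ Icc a b, ‖y s‖ ≤ (j : ℝ)) {t p q : ℝ}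
    (hp : p ≤ a + t) (hq : b + t ≤ q) :
    paramIntegral (ParamBMeasure.translate ν t) a b y =
      paramIntegral ν p q (shiftExtend a b t y) - ν.1 (y a) (Ioc p (a + t)) -
        ν.1 (y b) (Ioc (b + t) q) := by
  obtain ⟨-, l, hl⟩ := ν.2 j
  refine eq_of_abs_sub_le_all fun ε hε => ?_
  obtain ⟨η, hη, h'⟩ := hω.exists_mul_lt j (l.real (Ioc p q)) 0 (half_pos hε)
  obtain ⟨n, A, τ, hA, hτ, hAτ, hI⟩ := exists_partition_near
    (ν := ParamBMeasure.translate ν t) hω hab hy hyj (half_pos hε) hη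
  have hlt := h' η le_rfl
  rw [zero_add, hω.zero j, NNReal.coe_zero, mul_zero, zero_add] at hlt
  have hAt : IsBorelPartition (Ioc (a + t) (b + t)) fun i => (fun s => s + t) '' A i := by
    refine ⟨fun i => (MeasurableEquiv.addRight t).measurableSet_image.2 (hA.measurableSet i),
      fun i k hik => (Set.disjoint_image_iff (add_left_injective t)).2 (hA.disjoint hik), ?_⟩
    rw [← image_iUnion, hA.iUnion, image_add_const_Ioc]
  have habt : a + t ≤ b + t := by linarith
  -- The shifted pieces together with the left tail (`true`) and the right tail (`false`).
  let A' : Fin n ⊕ Bool → Set ℝ := Sum.elim (fun i => (fun s => s + t) '' A i)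
    (fun c => cond c (Ioc p (a + t)) (Ioc (b + t) q))
  have hA' : IsBorelPartition (Ioc p q) A' := by
    refine ⟨?_, ?_, ?_⟩
    · rintro (i | _ | _)
      exacts [hAt.measurableSet i, measurableSet_Ioc, measurableSet_Ioc]
    · have h1 : ∀ i, Disjoint ((fun s => s + t) '' A i) (Ioc p (a + t)) := fun i =>
        (Ioc_disjoint_Ioc_of_le le_rfl).symm.mono_left (hAt.subset i)
      have h2 : ∀ i, Disjoint ((fun s => s + t) '' A i) (Ioc (b + t) q) := fun i =>
        (Ioc_disjoint_Ioc_of_le le_rfl).mono_left (hAt.subset i)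
      have h3 : Disjoint (Ioc p (a + t)) (Ioc (b + t) q) := Ioc_disjoint_Ioc_of_le habt
      rintro (i | _ | _) (k | _ | _) hik
      · exact hAt.disjoint fun h => hik (congrArg _ h)
      · exact h2 i
      · exact h1 i
      · exact (h2 k).symm
      · exact absurd rfl hik
      · exact h3.symm
      · exact (h1 k).symm
      · exact h3
      · exact absurd rfl hik
    · rw [iUnion_sum]
      have : ⋃ c, A' (Sum.inr c) = Ioc p (a + t) ∪ Ioc (b + t) q := union_eq_iUnion.symm
      rw [this]
      change (⋃ i, (fun s => s + t) '' A i) ∪ _ = _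
      rw [hAt.iUnion, ← union_assoc, union_comm (Ioc (a + t) _), Ioc_union_Ioc_eq_Ioc hp habt,
        Ioc_union_Ioc_eq_Ioc (hp.trans habt) hq]
  have haI : a ∈ Icc a b := left_mem_Icc.2 hab.le
  have hbI : b ∈ Icc a b := right_mem_Icc.2 hab.le
  let x : Fin n ⊕ Bool → EuclideanSpace ℝ (Fin N) :=
    Sum.elim (fun i => y (τ i)) (fun c => cond c (y a) (y b))
  have hx : ∀ i, ‖x i‖ ≤ (j : ℝ) := by
    rintro (i | _ | _)
    exacts [hyj _ (hτ i), hyj _ hbI, hyj _ haI]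
  have h1 := abs_paramIntegral_sub_sum_le (ν := ν) hω (by linarith) hl
    (continuous_shiftExtend hab.le hy t).continuousOn
    (fun s _ => hyj _ (clamp_mem_Icc hab.le _)) hA' hx (η := η) (by
      rintro (i | _ | _) s hs
      · obtain ⟨s, hs, rfl⟩ := hs
        have e : shiftExtend a b t y (s + t) = y s := by
          simp only [shiftExtend, add_sub_cancel_right]
          rw [clamp_eq (Ioc_subset_Icc_self (hA.subset i hs))]
        rw [e, norm_sub_rev]
        exact hAτ i s hs
      · have e : shiftExtend a b t y s = y b := by
          have : b + t < s := hs.1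
          simp only [shiftExtend]
          rw [min_eq_left (by linarith), max_eq_right hab.le]
        rw [e]
        simp [x]
      · have e : shiftExtend a b t y s = y a := by
          have : s ≤ a + t := hs.2
          simp only [shiftExtend]
          rw [min_eq_right (by linarith), max_eq_left (by linarith)]
        rw [e]
        simp [x])
  rw [Fintype.sum_sum_type, Fintype.sum_bool] at h1
  have e : ∑ i, (ParamBMeasure.translate ν t).1 (y (τ i)) (A i) =
    ∑ i, ν.1 (x (Sum.inl i)) (A' (Sum.inl i)) := rfl
  rw [e] at hI
  change |_ - (_ + (ν.1 (y a) (Ioc p (a + t)) + ν.1 (y b) (Ioc (b + t) q)))| ≤ _ at h1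
  have h3 := abs_lt.1 hI
  have h4 := abs_le.1 h1
  rw [abs_le]
  constructor <;> linarith

end Integral

/-! ### Topologies generated by seminorms, and compactness of closures. -/

section SeminormTopology

open Topology Filter

variable {X ι : Type*} [AddCommGroup X]

/-- The topology generated by the balls of a family of seminorms of additive groups. -/
@[reducible]
def seminormTopology (p : ι → AddGroupSeminorm X) : TopologicalSpace X :=
  TopologicalSpace.generateFrom {U | ∃ i, ∃ (x : X) (r : ℝ), 0 < r ∧ U = {z | p i (z - x) < r}}

theorem seminormTopology_eq_iInf (p : ι → AddGroupSeminorm X) :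
    seminormTopology p =
      ⨅ i, (p i).toSeminormedAddCommGroup.toPseudoMetricSpace.toUniformSpace.toTopologicalSpace := by
  have e : {U | ∃ i, ∃ (x : X) (r : ℝ), 0 < r ∧ U = {z | p i (z - x) < r}} =
      ⋃ i, {U | ∃ (x : X) (r : ℝ), 0 < r ∧ U = {z | p i (z - x) < r}} := by
    ext U
    simp
  unfold seminormTopology
  rw [e, generateFrom_iUnion]
  refine iInf_congr fun i => ?_
  let := (p i).toSeminormedAddCommGroup
  have hball : ∀ x r, {z | p i (z - x) < r} = Metric.ball x r := by
    intro x r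
    ext z
    rw [Metric.mem_ball, dist_eq_norm]
    rfl
  refine (TopologicalSpace.IsTopologicalBasis.eq_generateFrom
    (TopologicalSpace.isTopologicalBasis_of_isOpen_of_nhds ?_ ?_)).symm
  · rintro _ ⟨x, r, -, rfl⟩
    rw [hball]
    exact Metric.isOpen_ball
  · intro x U hx hU
    obtain ⟨r, hr, h⟩ := Metric.isOpen_iff.1 hU x hx
    exact ⟨_, ⟨x, r, hr, rfl⟩, by rw [hball]; exact Metric.mem_ball_self hr, by rwa [hball]⟩

theorem regularSpace_seminormTopology (p : ι → AddGroupSeminorm X) :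
    @RegularSpace X (seminormTopology p) := by
  rw [seminormTopology_eq_iInf]
  refine regularSpace_iInf fun i => ?_
  let := (p i).toSeminormedAddCommGroup
  infer_instance

theorem tendsto_seminormTopology_iff (p : ι → AddGroupSeminorm X) {β : Type*} {f : β → X}
    {l : Filter β} {x : X} :
    Tendsto f l (@nhds X (seminormTopology p) x) ↔
      ∀ i, Tendsto (fun b => p i (f b - x)) l (𝓝 0) := by
  rw [seminormTopology_eq_iInf, nhds_iInf, tendsto_iInf]
  refine forall_congr' fun i => ?_
  let := (p i).toSeminormedAddCommGroup
  rw [tendsto_iff_norm_sub_tendsto_zero]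
  rfl

/-- An ultrafilter `G` on the closure need not contain `S`, but the traces on `S` of its open
members generate a filter. Let a finer ultrafilter converge to `x`. If a closed neighbourhood of `x`
were not in `G`, the trace of its open complement would contradict this convergence; by regularity,
`G` itself converges to `x`. -/
theorem isCompact_closure_of_ultrafilter {Y : Type*} [TopologicalSpace Y] [RegularSpace Y] {S : Set Y}
    (h : ∀ F : Ultrafilter Y, S ∈ F → ∃ x, (F : Filter Y) ≤ 𝓝 x) : IsCompact (closure S) := by
  rw [isCompact_iff_ultrafilter_le_nhds']
  intro G hG
  have hopen : ∀ U : Set Y, IsOpen U → U ∈ G → (U ∩ S).Nonempty := fun U hU hUG => by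
    obtain ⟨x, hxU, hxS⟩ := G.nonempty_of_mem (inter_mem hUG hG)
    exact mem_closure_iff.1 hxS U hU hxU
  let B : FilterBasis Y :=
    { sets := {V | ∃ U, IsOpen U ∧ U ∈ G ∧ V = U ∩ S}
      nonempty := ⟨_, univ, isOpen_univ, univ_mem, rfl⟩
      inter_sets := by
        rintro _ _ ⟨U, hU, hUG, rfl⟩ ⟨V, hV, hVG, rfl⟩
        exact ⟨_, ⟨U ∩ V, hU.inter hV, inter_mem hUG hVG, rfl⟩, by
          rintro x ⟨⟨h1, h2⟩, h3⟩
          exact ⟨⟨h1, h3⟩, h2, h3⟩⟩ }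
  have hne : B.filter.NeBot := B.hasBasis.neBot_iff.2 (by
    rintro _ ⟨U, hU, hUG, rfl⟩
    exact hopen U hU hUG)
  have hB : ∀ U, IsOpen U → U ∈ G → U ∩ S ∈ Ultrafilter.of B.filter := fun U hU hUG =>
    Ultrafilter.of_le _ (B.mem_filter_of_mem ⟨U, hU, hUG, rfl⟩)
  obtain ⟨x, hx⟩ := h (Ultrafilter.of B.filter)
    (mem_of_superset (hB univ isOpen_univ univ_mem) inter_subset_right)
  have hGx : (G : Filter Y) ≤ 𝓝 x := by
    intro V hV
    obtain ⟨W, hW, hWc, hWV⟩ := exists_mem_nhds_isClosed_subset hV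
    refine mem_of_superset ?_ hWV
    by_contra hWG
    have h1 := hB Wᶜ hWc.isOpen_compl (Ultrafilter.compl_mem_iff_notMem.2 hWG)
    obtain ⟨z, hz1, hz2⟩ := (Ultrafilter.of B.filter).nonempty_of_mem (inter_mem h1 (hx hW))
    exact hz1.1 hz2
  exact ⟨x, isClosed_closure.mem_of_frequently_of_tendsto
    (Eventually.frequently hG) (tendsto_id'.2 hGx), hGx⟩

end SeminormTopology

/-! ### Finiteness and seminorm properties of the generating functionals. -/

section Seminorms

variable {N : ℕ} {ω : ℕ+ → ℝ≥0 → ℝ≥0} {θ : ℕ+ → ℚ → ℚ → ℝ≥0 → ℝ≥0} {j : ℕ+} {q₁ q₂ : ℚ}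

/-- Every curve in `B_j` stays within distance `j` of the zero curve, so the l-bound gives a
constant independent of the curve. -/
theorem exists_abs_paramIntegral_le (hω : IsModuliFamily ω) (ν : ParamBMeasure N ω) (j : ℕ+)
    {a b : ℝ} (hab : a < b) : ∃ C : ℝ, ∀ y : ℝ → EuclideanSpace ℝ (Fin N),
      ContinuousOn y (Icc a b) → (∀ s ∈ Icc a b, ‖y s‖ ≤ (j : ℝ)) →
      |paramIntegral ν a b y| ≤ C := by
  obtain ⟨-, l, hl⟩ := ν.2 j
  have h0 : ‖(0 : EuclideanSpace ℝ (Fin N))‖ ≤ (j : ℝ) := by simp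
  refine ⟨l.real (Ioc a b) * ω j (j : ℝ≥0) + |ν.1 0 (Ioc a b)|, fun y hy hyj => ?_⟩
  have h := abs_paramIntegral_sub_le hω hab hl (continuousOn_const (c := 0)) (fun _ _ => h0) hy hyj
    (η := (j : ℝ≥0)) (fun s hs => by simpa using hyj s hs)
  rw [paramIntegral_const hω hab ν h0, abs_sub_comm] at h
  linarith [abs_sub_abs_le_abs_sub (paramIntegral ν a b y) (ν.1 0 (Ioc a b))]

theorem seminormTheta_ne_top (hω : IsModuliFamily ω) (hq : q₁ < q₂) (ν : ParamBMeasure N ω) :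
    seminormTheta θ j q₁ q₂ ν ≠ ⊤ := by
  obtain ⟨C, hC⟩ := exists_abs_paramIntegral_le hω ν j (Rat.cast_lt (K := ℝ).2 hq)
  refine ne_top_of_le_ne_top (ENNReal.ofReal_ne_top (r := C)) ?_
  exact iSup₂_le fun y hy => ENNReal.ofReal_le_ofReal (hC y hy.1 hy.2.1)

theorem abs_paramIntegral_le_seminormTheta (hω : IsModuliFamily ω) (hq : q₁ < q₂)
    (ν : ParamBMeasure N ω) {y : ℝ → EuclideanSpace ℝ (Fin N)} (hy : y ∈ curveSet N θ j q₁ q₂) :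
    |paramIntegral ν q₁ q₂ y| ≤ (seminormTheta θ j q₁ q₂ ν).toReal := by
  rw [← ENNReal.ofReal_le_iff_le_toReal (seminormTheta_ne_top hω hq ν)]
  exact le_iSup₂ (f := fun y (_ : y ∈ curveSet N θ j q₁ q₂) =>
    ENNReal.ofReal |paramIntegral ν q₁ q₂ y|) y hy

theorem toReal_seminormTheta_le (ν : ParamBMeasure N ω) {C : ℝ} (hC : 0 ≤ C)
    (h : ∀ y ∈ curveSet N θ j q₁ q₂, |paramIntegral ν q₁ q₂ y| ≤ C) :
    (seminormTheta θ j q₁ q₂ ν).toReal ≤ C := by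
  refine ENNReal.toReal_le_of_le_ofReal hC ?_
  exact iSup₂_le fun y hy => ENNReal.ofReal_le_ofReal (h y hy)

theorem const_mem_curveSet {x : EuclideanSpace ℝ (Fin N)} (hx : ‖x‖ ≤ (j : ℝ)) :
    (fun _ => x) ∈ curveSet N θ j q₁ q₂ :=
  ⟨continuousOn_const, fun _ _ => hx, fun _ _ _ _ => by simp⟩

theorem abs_apply_Ioc_le_seminormTheta (hω : IsModuliFamily ω) (hq : q₁ < q₂)
    (ν : ParamBMeasure N ω) {x : EuclideanSpace ℝ (Fin N)} (hx : ‖x‖ ≤ (j : ℝ)) :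
    |ν.1 x (Ioc (q₁ : ℝ) q₂)| ≤ (seminormTheta θ j q₁ q₂ ν).toReal := by
  rw [← paramIntegral_const hω (Rat.cast_lt (K := ℝ).2 hq) ν hx]
  exact abs_paramIntegral_le_seminormTheta hω hq ν (const_mem_curveSet hx)

/-- The seminorm `p_{I,j}` as a real valued seminorm. -/
noncomputable def addGroupSeminormTheta (hω : IsModuliFamily ω) (θ : ℕ+ → ℚ → ℚ → ℝ≥0 → ℝ≥0)
    (j : ℕ+) (q₁ q₂ : ℚ) (hq : q₁ < q₂) : AddGroupSeminorm (ParamBMeasure N ω) where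
  toFun ν := (seminormTheta θ j q₁ q₂ ν).toReal
  map_zero' := by
    refine le_antisymm (toReal_seminormTheta_le _ le_rfl fun y hy => ?_) ENNReal.toReal_nonneg
    have h := paramIntegral_sub hω (Rat.cast_lt (K := ℝ).2 hq) (0 : ParamBMeasure N ω) 0 hy.1 hy.2.1
    rw [sub_self, sub_self] at h
    rw [h, abs_zero]
  add_le' ν ν' := by
    refine toReal_seminormTheta_le _ (add_nonneg ENNReal.toReal_nonneg ENNReal.toReal_nonneg)
      fun y hy => ?_
    rw [paramIntegral_add hω (Rat.cast_lt (K := ℝ).2 hq) ν ν' hy.1 hy.2.1]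
    exact (abs_add_le _ _).trans (add_le_add (abs_paramIntegral_le_seminormTheta hω hq ν hy)
      (abs_paramIntegral_le_seminormTheta hω hq ν' hy))
  neg' ν := by
    have h : ∀ ν : ParamBMeasure N ω,
        (seminormTheta θ j q₁ q₂ (-ν)).toReal ≤ (seminormTheta θ j q₁ q₂ ν).toReal := fun ν => by
      refine toReal_seminormTheta_le _ ENNReal.toReal_nonneg fun y hy => ?_
      rw [paramIntegral_neg hω (Rat.cast_lt (K := ℝ).2 hq) ν hy.1 hy.2.1, abs_neg]
      exact abs_paramIntegral_le_seminormTheta hω hq ν hy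
    refine le_antisymm (h ν) ?_
    simpa using h (-ν)

theorem sigmaTheta_eq (hω : IsModuliFamily ω) (θ : ℕ+ → ℚ → ℚ → ℝ≥0 → ℝ≥0) :
    sigmaTheta N ω θ = seminormTopology fun i : ℕ+ × {q : ℚ × ℚ // q.1 < q.2} =>
      addGroupSeminormTheta hω θ i.1 i.2.1.1 i.2.1.2 i.2.2 := by
  unfold sigmaTheta seminormTopology
  congr 1
  ext U
  constructor
  · rintro ⟨j, q₁, q₂, ν, r, hq, hr, rfl⟩
    refine ⟨⟨j, ⟨(q₁, q₂), hq⟩⟩, ν, r, hr, ?_⟩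
    ext μ
    exact ENNReal.lt_ofReal_iff_toReal_lt (seminormTheta_ne_top hω hq _)
  · rintro ⟨⟨j, ⟨⟨q₁, q₂⟩, hq⟩⟩, ν, r, hr, rfl⟩
    refine ⟨j, q₁, q₂, ν, r, hq, hr, ?_⟩
    ext μ
    exact (ENNReal.lt_ofReal_iff_toReal_lt (seminormTheta_ne_top hω hq _)).symm

/-- The seminorm `p_{I,y}` as an additive group seminorm. -/
def addGroupSeminormD (y : EuclideanSpace ℝ (Fin N)) (q₁ q₂ : ℚ) :
    AddGroupSeminorm (ParamBMeasure N ω) where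
  toFun ν := seminormD y q₁ q₂ ν
  map_zero' := abs_zero
  add_le' _ _ := abs_add_le _ _
  neg' _ := abs_neg _

theorem sigmaD_eq (D : Set (EuclideanSpace ℝ (Fin N))) :
    sigmaD N ω D = seminormTopology fun i : D × {q : ℚ × ℚ // q.1 < q.2} =>
      addGroupSeminormD (i.1 : EuclideanSpace ℝ (Fin N)) i.2.1.1 i.2.1.2 := by
  unfold sigmaD seminormTopology
  congr 1
  ext U
  constructor
  · rintro ⟨y, hy, q₁, q₂, ν, r, hq, hr, rfl⟩
    exact ⟨⟨⟨y, hy⟩, ⟨(q₁, q₂), hq⟩⟩, ν, r, hr, rfl⟩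
  · rintro ⟨⟨⟨y, hy⟩, ⟨⟨q₁, q₂⟩, hq⟩⟩, ν, r, hr, rfl⟩
    exact ⟨y, hy, q₁, q₂, ν, r, hq, hr, rfl⟩

end Seminorms

/-! ### Equicontinuity on the hull and joint continuity of translation. -/

section Continuity

open MeasureTheory Topology Filter

theorem BMeasure.continuous_cdf (μ : BMeasure) {m : Measure ℝ} (hm : IsContMeasure m)
    (h : ∀ s t, |μ (Ioc s t)| ≤ m.real (Ioc s t)) : Continuous μ.cdf := by
  obtain ⟨h1, -, h3⟩ := hm
  refine continuous_iff_continuousAt.2 fun b => tendsto_iff_dist_tendsto_zero.2 ?_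
  have h0 : Tendsto (fun u : ℝ => |u - b|) (𝓝 b) (𝓝 0) := by
    have : Continuous fun u : ℝ => |u - b| := by fun_prop
    simpa using this.tendsto b
  have hlim : Tendsto (fun u : ℝ => m.real (Icc (b - |u - b|) (b + |u - b|))) (𝓝 b) (𝓝 0) :=
    (ENNReal.tendsto_toReal ENNReal.zero_ne_top).comp ((tendsto_measure_Icc m b).comp h0)
  refine squeeze_zero (fun _ => dist_nonneg) (fun u => ?_) hlim
  have hmono : ∀ s t, Ioc s t ⊆ Icc (b - |u - b|) (b + |u - b|) → |μ (Ioc s t)| ≤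
      m.real (Icc (b - |u - b|) (b + |u - b|)) := fun s t hst =>
    (h s t).trans (measureReal_mono hst ((isBoundedBorel_Icc _ _).measure_lt_top m).ne)
  rw [Real.dist_eq]
  rcases le_total u b with hu | hu
  · rw [abs_sub_comm, ← μ.apply_Ioc hu]
    refine hmono _ _ fun s hs => ⟨?_, ?_⟩ <;> rw [abs_of_nonpos (sub_nonpos.2 hu)] <;>
      linarith [hs.1, hs.2]
  · rw [← μ.apply_Ioc hu]
    refine hmono _ _ fun s hs => ⟨?_, ?_⟩ <;> rw [abs_of_nonneg (sub_nonneg.2 hu)] <;>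
      linarith [hs.1, hs.2]

/-- The estimate is a closed condition on `(u, v)`, and rational pairs are dense in the open strip
`|u - v| < δ`. -/
theorem BMeasure.abs_cdf_sub_le_of_rat (μ : BMeasure) (hc : Continuous μ.cdf) {ε δ : ℝ}
    (hε : 0 ≤ ε) (h : ∀ q₁ q₂ : ℚ, q₁ < q₂ → (q₂ : ℝ) - q₁ < δ → |μ (Ioc (q₁ : ℝ) q₂)| ≤ ε)
    {u v : ℝ} (huv : |u - v| < δ) : |μ.cdf u - μ.cdf v| ≤ ε := by
  have hcl : IsClosed {p : ℝ × ℝ | |μ.cdf p.1 - μ.cdf p.2| ≤ ε} :=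
    isClosed_le (by fun_prop) continuous_const
  have hop : IsOpen {p : ℝ × ℝ | |p.1 - p.2| < δ} := isOpen_lt (by fun_prop) continuous_const
  have hd : DenseRange (Prod.map (Rat.cast : ℚ → ℝ) (Rat.cast : ℚ → ℝ)) :=
    Rat.denseRange_cast.prodMap Rat.denseRange_cast
  refine closure_minimal ?_ hcl (Dense.open_subset_closure_inter hd hop
    (show (u, v) ∈ {p : ℝ × ℝ | |p.1 - p.2| < δ} from huv))
  rintro _ ⟨h1, ⟨q₁, q₂⟩, rfl⟩
  change |(q₁ : ℝ) - q₂| < δ at h1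
  change |μ.cdf q₁ - μ.cdf q₂| ≤ ε
  rw [abs_lt] at h1
  rcases lt_trichotomy q₁ q₂ with hq | rfl | hq
  · rw [abs_sub_comm, ← μ.apply_Ioc (Rat.cast_le.2 hq.le)]
    exact h _ _ hq (by linarith)
  · simpa using hε
  · rw [← μ.apply_Ioc (Rat.cast_le.2 hq.le)]
    exact h _ _ hq (by linarith)

variable {N : ℕ} {ω : ℕ+ → ℝ≥0 → ℝ≥0} {θ : ℕ+ → ℚ → ℚ → ℝ≥0 → ℝ≥0}

theorem IsMBound.abs_le {ν : EuclideanSpace ℝ (Fin N) → BMeasure} {j : ℕ+} {m : Measure ℝ}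
    (hm : IsMBound ν j m) {A : Set ℝ} (hA : IsBoundedBorel A) {x : EuclideanSpace ℝ (Fin N)}
    (hx : ‖x‖ ≤ (j : ℝ)) : |ν x A| ≤ m.real A := by
  have := hm.1.1
  exact (ν x).abs_le_of_totalVar_le hA.1 (hm.2 A hA x hx) (hA.measure_lt_top m).ne

theorem exists_norm_le (x : EuclideanSpace ℝ (Fin N)) : ∃ j : ℕ+, ‖x‖ ≤ (j : ℝ) := by
  obtain ⟨n, hn⟩ := exists_nat_ge ‖x‖
  refine ⟨n.succPNat, hn.trans ?_⟩
  rw [Nat.succPNat_coe]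
  exact_mod_cast Nat.le_succ n

theorem ParamBMeasure.continuous_cdf (ν : ParamBMeasure N ω) (x : EuclideanSpace ℝ (Fin N)) :
    Continuous (ν.1 x).cdf := by
  obtain ⟨j, hj⟩ := exists_norm_le x
  obtain ⟨⟨m, hm⟩, -⟩ := ν.2 j
  exact (ν.1 x).continuous_cdf hm.1 fun s t => hm.abs_le (isBoundedBorel_Ioc s t) hj

theorem exists_forall_abs_apply_Ioc_le {Γ : Type*} {ν : Γ → EuclideanSpace ℝ (Fin N) → BMeasure}
    {m : Γ → Measure ℝ} {j : ℕ+} (hm : ∀ α, IsMBound (ν α) j (m α))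
    (he : EquicontinuousMeasures m) {ε : ℝ} (hε : 0 < ε) :
    ∃ δ > 0, ∀ α, ∀ x, ‖x‖ ≤ (j : ℝ) → ∀ s t, s ≤ t → t - s < δ → |ν α x (Ioc s t)| ≤ ε := by
  obtain ⟨δ, hδ, h⟩ := he ε hε
  refine ⟨δ, hδ, fun α x hx s t hst htδ => ?_⟩
  have := (hm α).1.1
  refine ((hm α).abs_le (isBoundedBorel_Ioc s t) hx).trans ?_
  refine ENNReal.toReal_le_of_le_ofReal hε.le ?_
  exact (measure_mono Ioc_subset_Icc_self).trans (h s t (sub_nonneg.2 hst) htδ α).le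

/-- Evaluations at rational intervals extend bounds for short intervals to the closure. -/
theorem abs_cdf_sub_le_of_mem_closure [TopologicalSpace (ParamBMeasure N ω)]
    {x : EuclideanSpace ℝ (Fin N)}
    (hev : ∀ q₁ q₂ : ℚ, q₁ < q₂ → Continuous fun ν : ParamBMeasure N ω => ν.1 x (Ioc (q₁ : ℝ) q₂))
    {S : Set (ParamBMeasure N ω)} {ε δ : ℝ} (hε : 0 ≤ ε)
    (hS : ∀ ν ∈ S, ∀ s t, s ≤ t → t - s < δ → |ν.1 x (Ioc s t)| ≤ ε)
    {ν : ParamBMeasure N ω} (hν : ν ∈ closure S) {u v : ℝ} (huv : |u - v| < δ) :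
    |(ν.1 x).cdf u - (ν.1 x).cdf v| ≤ ε := by
  refine (ν.1 x).abs_cdf_sub_le_of_rat (ParamBMeasure.continuous_cdf ν x) hε (fun q₁ q₂ hq hqδ => ?_) huv
  refine closure_minimal (fun κ hκ => hS κ hκ q₁ q₂ (Rat.cast_le.2 hq.le) hqδ)
    (isClosed_le (hev q₁ q₂ hq).abs continuous_const) hν

theorem continuous_apply_of_tendsto [T : TopologicalSpace (ParamBMeasure N ω)]
    {x : EuclideanSpace ℝ (Fin N)} {A : Set ℝ} (p : AddGroupSeminorm (ParamBMeasure N ω))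
    (hp : ∀ ν : ParamBMeasure N ω, |ν.1 x A| ≤ p ν)
    (h : ∀ ν : ParamBMeasure N ω, Tendsto (fun κ => p (κ - ν)) (𝓝 ν) (𝓝 0)) :
    Continuous fun ν : ParamBMeasure N ω => ν.1 x A := by
  refine continuous_iff_continuousAt.2 fun ν => tendsto_iff_dist_tendsto_zero.2 ?_
  exact squeeze_zero (fun _ => dist_nonneg) (fun κ => hp (κ - ν)) (h ν)

theorem continuous_apply_sigmaTheta (hω : IsModuliFamily ω) {j : ℕ+}
    {x : EuclideanSpace ℝ (Fin N)} (hx : ‖x‖ ≤ (j : ℝ)) {q₁ q₂ : ℚ} (hq : q₁ < q₂) :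
    @Continuous _ _ (sigmaTheta N ω θ) _
      fun ν : ParamBMeasure N ω => ν.1 x (Ioc (q₁ : ℝ) q₂) := by
  let := sigmaTheta N ω θ
  refine continuous_apply_of_tendsto (addGroupSeminormTheta hω θ j q₁ q₂ hq)
    (fun ν => abs_apply_Ioc_le_seminormTheta hω hq ν hx) fun ν => ?_
  have h : Tendsto id (@nhds _ (sigmaTheta N ω θ) ν) (@nhds _ (sigmaTheta N ω θ) ν) := tendsto_id
  nth_rw 2 [sigmaTheta_eq hω θ] at h
  exact (tendsto_seminormTopology_iff _).1 h (j, ⟨(q₁, q₂), hq⟩)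

theorem seminormD_eq {q₁ q₂ : ℚ} (hq : q₁ < q₂) (x : EuclideanSpace ℝ (Fin N))
    (ν : ParamBMeasure N ω) : seminormD x q₁ q₂ ν = |ν.1 x (Ioc (q₁ : ℝ) q₂)| := by
  rw [seminormD, (ν.1 x).apply_Icc (Rat.cast_le.2 hq.le)]

theorem tendsto_sigmaD_iff {D : Set (EuclideanSpace ℝ (Fin N))} {β : Type*} {l : Filter β}
    {κ : β → ParamBMeasure N ω} {ν : ParamBMeasure N ω} :
    Tendsto κ l (@nhds _ (sigmaD N ω D) ν) ↔ ∀ x ∈ D, ∀ q₁ q₂ : ℚ, q₁ < q₂ →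
      Tendsto (fun b => (κ b).1 x (Ioc (q₁ : ℝ) q₂)) l (𝓝 (ν.1 x (Ioc (q₁ : ℝ) q₂))) := by
  rw [sigmaD_eq, tendsto_seminormTopology_iff]
  have e : ∀ (x : EuclideanSpace ℝ (Fin N)) (q₁ q₂ : ℚ), q₁ < q₂ →
      (Tendsto (fun b => (addGroupSeminormD x q₁ q₂) (κ b - ν)) l (𝓝 0) ↔
      Tendsto (fun b => (κ b).1 x (Ioc (q₁ : ℝ) q₂)) l (𝓝 (ν.1 x (Ioc (q₁ : ℝ) q₂)))) := by
    intro x q₁ q₂ hq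
    rw [tendsto_iff_dist_tendsto_zero (a := ν.1 x (Ioc (q₁ : ℝ) q₂))]
    refine iff_of_eq (congrArg (fun f => Tendsto f l (𝓝 0)) (funext fun b => ?_))
    exact seminormD_eq hq x (κ b - ν)
  exact ⟨fun h x hx q₁ q₂ hq => (e x q₁ q₂ hq).1 (h (⟨x, hx⟩, ⟨(q₁, q₂), hq⟩)),
    fun h i => (e _ _ _ i.2.2).2 (h i.1 i.1.2 _ _ i.2.2)⟩

theorem continuous_apply_sigmaD {D : Set (EuclideanSpace ℝ (Fin N))}
    {x : EuclideanSpace ℝ (Fin N)} (hx : x ∈ D) {q₁ q₂ : ℚ} (hq : q₁ < q₂) :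
    @Continuous _ _ (sigmaD N ω D) _
      fun ν : ParamBMeasure N ω => ν.1 x (Ioc (q₁ : ℝ) q₂) := by
  let := sigmaD N ω D
  exact continuous_iff_continuousAt.2 fun ν => tendsto_sigmaD_iff.1 tendsto_id x hx q₁ q₂ hq

theorem exists_rat_near_gt {c δ p : ℝ} (hδ : 0 < δ) (hp : p < c) :
    ∃ r : ℚ, p < r ∧ |(r : ℝ) - c| < δ := by
  obtain ⟨r, hr1, hr2⟩ := exists_rat_btwn (max_lt hp (sub_lt_self c hδ))
  have h := max_lt_iff.1 hr1
  exact ⟨r, h.1, abs_lt.2 ⟨by linarith, by linarith⟩⟩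

theorem exists_rat_near_lt {c δ q : ℝ} (hδ : 0 < δ) (hq : c < q) :
    ∃ r : ℚ, r < q ∧ |(r : ℝ) - c| < δ := by
  obtain ⟨r, hr1, hr2⟩ := exists_rat_btwn (lt_min hq (lt_add_of_pos_right c hδ))
  have h := lt_min_iff.1 hr2
  exact ⟨r, h.1, abs_lt.2 ⟨by linarith, by linarith⟩⟩

variable {β : Type*} {l : Filter β} {τ : β → ℝ} {t : ℝ} {κ : β → ParamBMeasure N ω}
  {ν : ParamBMeasure N ω}

/-- Replaces the endpoint `u` of the limit and the moving endpoint `v` by one point `c`. It is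
applied with `c` rational, where the topology gives control. -/
theorem abs_cdf_sub_sub_le {μ μ' : BMeasure} {δ e c u v : ℝ}
    (hμ : ∀ u v, |u - v| < δ → |μ.cdf u - μ.cdf v| ≤ e)
    (hμ' : ∀ u v, |u - v| < δ → |μ'.cdf u - μ'.cdf v| ≤ e)
    (hc : |c - u| < δ / 2) (huv : |v - u| < δ / 2) :
    |(μ'.cdf v - μ.cdf u) - (μ'.cdf c - μ.cdf c)| ≤ 2 * e := by
  have hδ : 0 < δ / 2 := (abs_nonneg _).trans_lt hc
  have h1 := hμ' v c ((abs_sub_le v u c).trans_lt (by rw [abs_sub_comm u c]; linarith))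
  have h2 := hμ u c (by rw [abs_sub_comm]; linarith)
  rw [abs_le] at *
  constructor <;> linarith

theorem tendsto_translate_sigmaD {D : Set (EuclideanSpace ℝ (Fin N))}
    (hτ : Tendsto τ l (𝓝 t)) (hκ : Tendsto κ l (@nhds _ (sigmaD N ω D) ν))
    (he : ∀ x ∈ D, ∀ ε > 0, ∃ δ > 0, ∀ u v, |u - v| < δ →
      (∀ b, |((κ b).1 x).cdf u - ((κ b).1 x).cdf v| ≤ ε) ∧
        |(ν.1 x).cdf u - (ν.1 x).cdf v| ≤ ε) :
    Tendsto (fun b => ParamBMeasure.translate (κ b) (τ b)) l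
      (@nhds _ (sigmaD N ω D) (ParamBMeasure.translate ν t)) := by
  rw [tendsto_sigmaD_iff] at hκ ⊢
  intro x hx q₁ q₂ hq
  have hq' : (q₁ : ℝ) < q₂ := Rat.cast_lt.2 hq
  refine Metric.tendsto_nhds.2 fun ε hε => ?_
  -- Each of the two endpoints costs `2 * (ε / 6)`, and convergence on the rational interval another
  -- `ε / 6`.
  obtain ⟨δ, hδ, h⟩ := he x hx (ε / 6) (by positivity)
  -- Staying on opposite sides of the midpoint guarantees `r₁ < r₂`.
  obtain ⟨r₁, hr₁', hr₁⟩ := exists_rat_near_lt (c := q₁ + t) (q := (q₁ + q₂) / 2 + t)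
    (half_pos hδ) (by linarith)
  obtain ⟨r₂, hr₂', hr₂⟩ := exists_rat_near_gt (c := q₂ + t) (p := (q₁ + q₂) / 2 + t)
    (half_pos hδ) (by linarith)
  have hr : r₁ < r₂ := by exact_mod_cast hr₁'.trans hr₂'
  filter_upwards [Metric.tendsto_nhds.1 hτ (δ / 2) (half_pos hδ),
    Metric.tendsto_nhds.1 (hκ x hx r₁ r₂ hr) (ε / 6) (by positivity)] with b hb hb'
  rw [Real.dist_eq] at hb hb' ⊢
  have hsh : ∀ c : ℝ, |(c + τ b) - (c + t)| < δ / 2 := fun c => by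
    rwa [add_sub_add_left_eq_sub]
  have h1 := abs_cdf_sub_sub_le (fun u v huv => (h u v huv).2) (fun u v huv => (h u v huv).1 b)
    hr₁ (hsh q₁)
  have h2 := abs_cdf_sub_sub_le (fun u v huv => (h u v huv).2) (fun u v huv => (h u v huv).1 b)
    hr₂ (hsh q₂)
  have e : ∀ (ν : ParamBMeasure N ω) (t : ℝ), (ParamBMeasure.translate ν t).1 x (Ioc (q₁ : ℝ) q₂) =
      (ν.1 x).cdf (q₂ + t) - (ν.1 x).cdf (q₁ + t) := fun ν t => by
    rw [← BMeasure.apply_Ioc _ (by linarith)]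
    exact BMeasure.translate_Ioc _ _ _ _
  rw [e, e]
  rw [BMeasure.apply_Ioc _ (Rat.cast_le.2 hr.le), BMeasure.apply_Ioc _ (Rat.cast_le.2 hr.le)] at hb'
  rw [abs_lt] at hb' ⊢
  rw [abs_le] at h1 h2
  constructor <;> linarith

/-- Clamping is 1-Lipschitz, so the modulus survives, and `Θ` increases with the interval. -/
theorem shiftExtend_mem_curveSet (hθ : IsSuitable θ) {j : ℕ+} {q₁ q₂ p₁ p₂ : ℚ} (hq : q₁ < q₂)
    (hp₁ : p₁ ≤ q₁) (hp₂ : q₂ ≤ p₂) {y : ℝ → EuclideanSpace ℝ (Fin N)}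
    (hy : y ∈ curveSet N θ j q₁ q₂) (t : ℝ) :
    shiftExtend (q₁ : ℝ) q₂ t y ∈ curveSet N θ j p₁ p₂ := by
  have hq' : (q₁ : ℝ) ≤ q₂ := Rat.cast_le.2 hq.le
  refine ⟨(continuous_shiftExtend hq' hy.1 t).continuousOn,
    fun s _ => hy.2.1 _ (clamp_mem_Icc hq' _), fun s _ u _ => ?_⟩
  refine (hy.2.2 _ (clamp_mem_Icc hq' (s - t)) _ (clamp_mem_Icc hq' (u - t))).trans ?_
  refine (hθ.monotone j q₁ q₂ hq ?_).trans
    (hθ.le j j q₁ q₂ p₁ p₂ le_rfl hq ((hp₁.trans_lt hq).trans_le hp₂) hp₁ hp₂ _)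
  change |_| ≤ |s - u|
  refine (abs_clamp_sub_le _ _ _ _).trans_eq ?_
  rw [sub_sub_sub_cancel_right]

theorem norm_shiftExtend_sub_le {j : ℕ+} {q₁ q₂ : ℚ} (hq : q₁ < q₂) (hθ : IsSuitable θ)
    {y : ℝ → EuclideanSpace ℝ (Fin N)} (hy : y ∈ curveSet N θ j q₁ q₂) {t t' : ℝ} {r : ℝ≥0}
    (h : |t' - t| ≤ r) (s : ℝ) :
    ‖shiftExtend (q₁ : ℝ) q₂ t y s - shiftExtend (q₁ : ℝ) q₂ t' y s‖ ≤ θ j q₁ q₂ r := by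
  have hq' : (q₁ : ℝ) ≤ q₂ := Rat.cast_le.2 hq.le
  refine (NNReal.coe_le_coe.2 (hy.2.2 _ (clamp_mem_Icc hq' (s - t)) _
    (clamp_mem_Icc hq' (s - t')))).trans (NNReal.coe_le_coe.2 (hθ.monotone j q₁ q₂ hq ?_))
  change |_| ≤ (r : ℝ)
  refine (abs_clamp_sub_le _ _ _ _).trans ?_
  rwa [sub_sub_sub_cancel_left]

theorem IsSuitable.exists_le (hθ : IsSuitable θ) (j : ℕ+) {q₁ q₂ : ℚ} (hq : q₁ < q₂) {η : ℝ≥0}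
    (hη : 0 < η) : ∃ r : ℝ≥0, 0 < r ∧ θ j q₁ q₂ r ≤ η := by
  have h := (hθ.continuous j q₁ q₂ hq).tendsto 0
  rw [hθ.zero j q₁ q₂ hq] at h
  obtain ⟨ρ, hρ, h'⟩ := Metric.eventually_nhds_iff.1 (h.eventually_lt_const hη)
  refine ⟨(ρ / 2).toNNReal, Real.toNNReal_pos.2 (half_pos hρ), (h' ?_).le⟩
  rw [NNReal.dist_eq, NNReal.coe_zero, sub_zero, NNReal.abs_eq, Real.coe_toNNReal _ (half_pos hρ).le]
  exact half_lt_self hρ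

theorem tendsto_translate_sigmaTheta (hω : IsModuliFamily ω) (hθ : IsSuitable θ)
    (hτ : Tendsto τ l (𝓝 t)) (hκ : Tendsto κ l (@nhds _ (sigmaTheta N ω θ) ν))
    (he : ∀ j : ℕ+, ∀ ε > 0, ∃ δ > 0, ∀ x : EuclideanSpace ℝ (Fin N), ‖x‖ ≤ (j : ℝ) →
      ∀ u v, |u - v| < δ → (∀ b, |((κ b).1 x).cdf u - ((κ b).1 x).cdf v| ≤ ε) ∧
        |(ν.1 x).cdf u - (ν.1 x).cdf v| ≤ ε) :
    Tendsto (fun b => ParamBMeasure.translate (κ b) (τ b)) l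
      (@nhds _ (sigmaTheta N ω θ) (ParamBMeasure.translate ν t)) := by
  rw [sigmaTheta_eq hω, tendsto_seminormTopology_iff] at hκ ⊢
  rintro ⟨j, ⟨⟨a, b⟩, hab : a < b⟩⟩
  have hab' : (a : ℝ) < b := Rat.cast_lt.2 hab
  refine Metric.tendsto_nhds.2 fun ε hε => ?_
  -- The change of measure and the change of curve cost `ε / 10` each, and each tail costs `3 * (ε /
  -- 10)`.
  obtain ⟨δ, hδ, h⟩ := he j (ε / 10) (by positivity)
  -- `[p, q]` contains `[a, b]`, so that `Θ` can be compared, and strictly contains `[a + t, b +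
  -- t]`, so that it also contains the nearby translates.
  obtain ⟨p, hp⟩ := exists_rat_lt (min (a : ℝ) (a + t))
  obtain ⟨q, hq⟩ := exists_rat_gt (max (b : ℝ) (b + t))
  obtain ⟨hp1, hp2⟩ := lt_min_iff.1 hp
  obtain ⟨hq1, hq2⟩ := max_lt_iff.1 hq
  have hpa : p < a := Rat.cast_lt.1 hp1
  have hbq : b < q := Rat.cast_lt.1 hq1
  have hpq : p < q := (hpa.trans hab).trans hbq
  have hpq' : (p : ℝ) < q := Rat.cast_lt.2 hpq
  obtain ⟨r₁, hr₁', hr₁⟩ := exists_rat_near_gt (half_pos hδ) hp2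
  obtain ⟨r₂, hr₂', hr₂⟩ := exists_rat_near_lt (half_pos hδ) hq2
  have hpr : p < r₁ := Rat.cast_lt.1 hr₁'
  have hrq : r₂ < q := Rat.cast_lt.1 hr₂'
  obtain ⟨-, L, hL⟩ := ν.2 j
  obtain ⟨η, hη, hη'⟩ := hω.exists_mul_lt j (L.real (Ioc (p : ℝ) q)) 0
    (show 0 < ε / 10 by positivity)
  obtain ⟨ρ, hρ, hρ'⟩ := hθ.exists_le j hab hη
  have hlt := hη' _ hρ'
  rw [zero_add, hω.zero j, NNReal.coe_zero, mul_zero, zero_add] at hlt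
  have hgap : 0 < min (min (δ / 2) ρ) (min (a + t - p) (q - (b + t))) :=
    lt_min (lt_min (half_pos hδ) hρ) (lt_min (by linarith) (by linarith))
  have hε10 : 0 < ε / 10 := by positivity
  filter_upwards [Metric.tendsto_nhds.1 hτ _ hgap,
    (hκ (j, ⟨(p, q), hpq⟩)).eventually_lt_const hε10,
    (hκ (j, ⟨(p, r₁), hpr⟩)).eventually_lt_const hε10,
    (hκ (j, ⟨(r₂, q), hrq⟩)).eventually_lt_const hε10] with i hi h1 h2 h3
  rw [Real.dist_eq] at hi
  simp only [lt_min_iff] at hi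
  obtain ⟨⟨hi1, hi2⟩, hi3, hi4⟩ := hi
  have hi5 := abs_lt.1 hi3
  have hi6 := abs_lt.1 hi4
  rw [Real.dist_eq, sub_zero]
  have hle : (seminormTheta θ j a b (ParamBMeasure.translate (κ i) (τ i) -
      ParamBMeasure.translate ν t)).toReal ≤ 9 * (ε / 10) := by
    refine toReal_seminormTheta_le _ (by positivity) fun y hy => ?_
    have hz := shiftExtend_mem_curveSet hθ hab hpa.le hbq.le hy (τ i)
    have hz' := shiftExtend_mem_curveSet hθ hab hpa.le hbq.le hy t
    rw [paramIntegral_sub hω hab' _ _ hy.1 hy.2.1,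
      paramIntegral_translate (p := p) (q := q) hω hab' hy.1 hy.2.1 (by linarith) (by linarith),
      paramIntegral_translate (p := p) (q := q) hω hab' hy.1 hy.2.1 (by linarith) (by linarith)]
    have k1 := (abs_paramIntegral_le_seminormTheta hω hpq (κ i - ν) hz).trans_lt h1
    rw [paramIntegral_sub hω hpq' _ _ hz.1 hz.2.1] at k1
    have k2 := (abs_paramIntegral_sub_le hω hpq' hL hz'.1 hz'.2.1 hz.1 hz.2.1
      (fun s _ => norm_shiftExtend_sub_le hab hθ hy (t := τ i) (t' := t) (r := ρ)
        (by rw [abs_sub_comm]; exact hi2.le) s)).trans_lt hlt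
    have hya := hy.2.1 a (left_mem_Icc.2 hab'.le)
    have hyb := hy.2.1 b (right_mem_Icc.2 hab'.le)
    have k3 := (abs_apply_Ioc_le_seminormTheta hω hpr (κ i - ν) hya).trans_lt h2
    have k4 := (abs_apply_Ioc_le_seminormTheta hω hrq (κ i - ν) hyb).trans_lt h3
    have hsh : ∀ c : ℝ, |(c + τ i) - (c + t)| < δ / 2 := fun c => by
      rwa [add_sub_add_left_eq_sub]
    have k5 := abs_cdf_sub_sub_le (fun u v huv => (h _ hya u v huv).2)
      (fun u v huv => (h _ hya u v huv).1 i) hr₁ (hsh a)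
    have k6 := abs_cdf_sub_sub_le (fun u v huv => (h _ hyb u v huv).2)
      (fun u v huv => (h _ hyb u v huv).1 i) hr₂ (hsh b)
    rw [BMeasure.apply_Ioc _ (Rat.cast_le.2 hpr.le)] at k3
    rw [BMeasure.apply_Ioc _ (Rat.cast_le.2 hrq.le)] at k4
    have es : ∀ x s, ((κ i - ν).1 x).cdf s = ((κ i).1 x).cdf s - (ν.1 x).cdf s := fun x s =>
      BMeasure.cdf_sub _ _ _
    rw [es, es] at k3 k4
    rw [BMeasure.apply_Ioc _ (by linarith), BMeasure.apply_Ioc _ (by linarith),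
      BMeasure.apply_Ioc _ (by linarith), BMeasure.apply_Ioc _ (by linarith)]
    rw [abs_lt] at k1 k2 k3 k4
    rw [abs_le] at k5 k6 ⊢
    constructor <;> linarith
  refine lt_of_le_of_lt (b := 9 * (ε / 10)) ?_ (by linarith)
  exact (abs_of_nonneg ENNReal.toReal_nonneg).trans_le hle

/-- Joint continuity of the translation on a closed set makes the translation a flow there. -/
theorem exists_flow_hull [TopologicalSpace (ParamBMeasure N ω)] (ν₀ : ParamBMeasure N ω)
    (h : ∀ (t : ℝ) (ν : hull ν₀), Tendsto
      (fun p : ℝ × hull ν₀ => ParamBMeasure.translate (p.2 : ParamBMeasure N ω) p.1)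
      (𝓝 (t, ν)) (𝓝 (ParamBMeasure.translate (ν : ParamBMeasure N ω) t))) :
    ∃ φ : Flow ℝ (hull ν₀), ∀ (t : ℝ) (ν : hull ν₀),
      (φ t ν : ParamBMeasure N ω) = ParamBMeasure.translate (ν : ParamBMeasure N ω) t := by
  have hadd : ∀ (ν : ParamBMeasure N ω) (s t : ℝ), ParamBMeasure.translate ν (s + t) =
      ParamBMeasure.translate (ParamBMeasure.translate ν t) s := by
    intro ν s t
    refine Subtype.ext (funext fun x => BMeasure.toFun_injective (funext fun A => ?_))
    change ν.1 x _ = ν.1 x _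
    rw [image_image]
    simp only [add_assoc]
  have hzero : ∀ ν : ParamBMeasure N ω, ParamBMeasure.translate ν 0 = ν := by
    intro ν
    refine Subtype.ext (funext fun x => BMeasure.toFun_injective (funext fun A => ?_))
    change ν.1 x _ = ν.1 x _
    simp
  have hcont : Continuous fun p : ℝ × hull ν₀ =>
      ParamBMeasure.translate (p.2 : ParamBMeasure N ω) p.1 :=
    continuous_iff_continuousAt.2 fun p => h p.1 p.2
  -- Translation is known to be continuous only on the hull; this suffices, since the hull is the
  -- closure of an orbit that translation preserves.
  have hinv : ∀ (t : ℝ), ∀ ν ∈ hull ν₀, ParamBMeasure.translate ν t ∈ hull ν₀ := by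
    intro t ν hν
    have hc : ContinuousOn (fun κ : ParamBMeasure N ω => ParamBMeasure.translate κ t) (hull ν₀) :=
      continuousOn_iff_continuous_domRestrict.2
        (hcont.comp (continuous_const.prodMk continuous_id) : _)
    refine closure_mono ?_ (hc.image_closure ⟨ν, hν, rfl⟩)
    rintro _ ⟨_, ⟨s, rfl⟩, rfl⟩
    exact ⟨t + s, hadd ν₀ t s⟩
  exact ⟨⟨fun t ν => ⟨_, hinv t ν ν.2⟩, hcont.subtype_mk _,
    fun s t ν => Subtype.ext (hadd ν s t), fun ν => Subtype.ext (hzero ν)⟩, fun _ _ => rfl⟩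

theorem exists_flow_hull_sigmaTheta (hω : IsModuliFamily ω) (hθ : IsSuitable θ)
    {ν₀ : ParamBMeasure N ω} (hm : HasEquicontMBounds ν₀) [T : TopologicalSpace (ParamBMeasure N ω)]
    (hT : T = sigmaTheta N ω θ) :
    ∃ φ : Flow ℝ (hull ν₀), ∀ (t : ℝ) (ν : hull ν₀),
      (φ t ν : ParamBMeasure N ω) = ParamBMeasure.translate (ν : ParamBMeasure N ω) t := by
  subst hT
  let := sigmaTheta N ω θ
  refine exists_flow_hull ν₀ fun t ν => ?_
  refine tendsto_translate_sigmaTheta hω hθ (continuous_fst.tendsto (t, ν))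
    ((continuous_subtype_val.comp continuous_snd).tendsto (t, ν)) fun j ε hε => ?_
  obtain ⟨m, hm⟩ := hm
  obtain ⟨δ, hδ, h⟩ := exists_forall_abs_apply_Ioc_le (hm j).1 (hm j).2 hε
  have key : ∀ κ ∈ hull ν₀, ∀ x : EuclideanSpace ℝ (Fin N), ‖x‖ ≤ (j : ℝ) → ∀ u v, |u - v| < δ →
      |(κ.1 x).cdf u - (κ.1 x).cdf v| ≤ ε := fun κ hκ x hx u v huv => by
    refine abs_cdf_sub_le_of_mem_closure
      (fun q₁ q₂ hq => continuous_apply_sigmaTheta hω hx hq) hε.le ?_ hκ huv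
    rintro _ ⟨s, rfl⟩
    exact h s x hx
  exact ⟨δ, hδ, fun x hx u v huv => ⟨fun p => key _ p.2.2 x hx u v huv, key _ ν.2 x hx u v huv⟩⟩

theorem exists_flow_hull_sigmaD {D : Set (EuclideanSpace ℝ (Fin N))}
    {ν₀ : ParamBMeasure N ω} (hm : HasEquicontMBounds ν₀) [T : TopologicalSpace (ParamBMeasure N ω)]
    (hT : T = sigmaD N ω D) :
    ∃ φ : Flow ℝ (hull ν₀), ∀ (t : ℝ) (ν : hull ν₀),
      (φ t ν : ParamBMeasure N ω) = ParamBMeasure.translate (ν : ParamBMeasure N ω) t := by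
  subst hT
  let := sigmaD N ω D
  refine exists_flow_hull ν₀ fun t ν => ?_
  refine tendsto_translate_sigmaD (continuous_fst.tendsto (t, ν))
    ((continuous_subtype_val.comp continuous_snd).tendsto (t, ν)) fun x hx ε hε => ?_
  obtain ⟨m, hm⟩ := hm
  obtain ⟨j, hj⟩ := exists_norm_le x
  obtain ⟨δ, hδ, h⟩ := exists_forall_abs_apply_Ioc_le (hm j).1 (hm j).2 hε
  have key : ∀ κ ∈ hull ν₀, ∀ u v, |u - v| < δ →
      |(κ.1 x).cdf u - (κ.1 x).cdf v| ≤ ε := fun κ hκ u v huv => by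
    refine abs_cdf_sub_le_of_mem_closure
      (fun q₁ q₂ hq => continuous_apply_sigmaD hx hq) hε.le ?_ hκ huv
    rintro _ ⟨s, rfl⟩
    exact h s x hj
  exact ⟨δ, hδ, fun u v huv => ⟨fun p => key _ p.2.2 u v huv, key _ ν.2 u v huv⟩⟩

end Continuity

/-! ### Pointwise limits of distribution functions along ultrafilters. -/

section Limits

open MeasureTheory Topology Filter

/-- The point `s` is reached from `0` in a number of steps shorter than `δ` that does not depend on
`α`. -/
theorem exists_abs_le_of_abs_sub_le {Γ : Type*} {f : Γ → ℝ → ℝ} (h0 : ∀ α, f α 0 = 0) {c δ : ℝ}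
    (hδ : 0 < δ) (h : ∀ α s t, s ≤ t → t - s < δ → |f α t - f α s| ≤ c) (s : ℝ) :
    ∃ C, ∀ α, |f α s| ≤ C := by
  obtain ⟨n, hn⟩ := exists_nat_gt (|s| / δ)
  have hn0 : (0 : ℝ) < n := (div_nonneg (abs_nonneg s) hδ.le).trans_lt hn
  have hs : |s / n| < δ := by
    rw [abs_div, Nat.abs_cast, div_lt_iff₀ hn0]
    rwa [div_lt_iff₀ hδ, mul_comm] at hn
  have h' : ∀ α u v, |u - v| < δ → |f α u - f α v| ≤ c := fun α u v huv => by
    rw [abs_lt] at huv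
    rcases le_total u v with huv' | huv'
    · rw [abs_sub_comm]
      exact h α u v huv' (by linarith)
    · exact h α v u huv' (by linarith)
  refine ⟨n * c, fun α => ?_⟩
  have key : ∀ k : ℕ, |f α (k * (s / n))| ≤ k * c := by
    intro k
    induction k with
    | zero => simp [h0]
    | succ k ih =>
      have h1 := h' α ((k + 1 : ℕ) * (s / n)) (k * (s / n)) (by
        have e : ((k + 1 : ℕ) : ℝ) * (s / n) - k * (s / n) = s / n := by
          push_cast
          ring
        rwa [e])
      have h2 := abs_sub_abs_le_abs_sub (f α ((k + 1 : ℕ) * (s / n))) (f α (k * (s / n)))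
      push_cast at *
      linarith
  have := key n
  rwa [mul_div_cancel₀ s hn0.ne'] at this

theorem exists_tendsto_of_abs_sub_le {Γ : Type*} {f : Γ → ℝ → ℝ} (h0 : ∀ α, f α 0 = 0) {c δ : ℝ}
    (hδ : 0 < δ) (h : ∀ α s t, s ≤ t → t - s < δ → |f α t - f α s| ≤ c) (F : Ultrafilter Γ) :
    ∃ g : ℝ → ℝ, ∀ s, Tendsto (fun α => f α s) F (𝓝 (g s)) := by
  have key : ∀ s, ∃ x, Tendsto (fun α => f α s) F (𝓝 x) := by
    intro s
    obtain ⟨C, hC⟩ := exists_abs_le_of_abs_sub_le h0 hδ h s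
    obtain ⟨x, -, hx⟩ := (isCompact_Icc (a := -C) (b := C)).ultrafilter_le_nhds
      (F.map fun α => f α s) (by
        rw [le_principal_iff]
        exact mem_map.2 (univ_mem' fun α => abs_le.1 (hC α)))
    exact ⟨x, hx⟩
  choose g hg using key
  exact ⟨g, hg⟩

/-- The distribution function of a locally finite measure without atoms, vanishing at `0`. -/
noncomputable def IsContMeasure.cdf {m : Measure ℝ} (hm : IsContMeasure m) : ℝ → ℝ :=
  (BMeasure.ofDiff m 0 hm isContMeasure_zero).cdf

theorem IsContMeasure.cdf_sub {m : Measure ℝ} (hm : IsContMeasure m) {s t : ℝ} (hst : s ≤ t) :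
    hm.cdf t - hm.cdf s = m.real (Ioc s t) := by
  unfold IsContMeasure.cdf
  rw [← BMeasure.apply_Ioc _ hst, BMeasure.ofDiff_apply _ _ (isBoundedBorel_Ioc s t)]
  simp

theorem IsContMeasure.cdf_zero {m : Measure ℝ} (hm : IsContMeasure m) : hm.cdf 0 = 0 :=
  BMeasure.cdf_zero _

theorem BoundedMeasures.abs_cdf_sub_le {Γ : Type*} {l : Γ → Measure ℝ}
    (hl : ∀ α, IsContMeasure (l α)) (h : BoundedMeasures l) :
    ∃ c : ℝ, ∀ α s t, s ≤ t → t - s < 1 → |(hl α).cdf t - (hl α).cdf s| ≤ c := by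
  obtain ⟨c, hc, h⟩ := h
  refine ⟨c, fun α s t hst hst' => ?_⟩
  rw [(hl α).cdf_sub hst, abs_of_nonneg measureReal_nonneg]
  refine ENNReal.toReal_le_of_le_ofReal hc.le ((measure_mono ?_).trans (h s α))
  exact Ioc_subset_Icc_self.trans (Icc_subset_Icc_right (by linarith))

theorem BoundedMeasures.exists_real_Ioc_le {Γ : Type*} {l : Γ → Measure ℝ}
    (hl : ∀ α, IsContMeasure (l α)) (h : BoundedMeasures l) {a b : ℝ} (hab : a ≤ b) :
    ∃ C : ℝ, ∀ α, (l α).real (Ioc a b) ≤ C := by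
  obtain ⟨c, hc⟩ := h.abs_cdf_sub_le hl
  obtain ⟨A, hA⟩ := exists_abs_le_of_abs_sub_le (fun α => (hl α).cdf_zero) one_pos hc a
  obtain ⟨B, hB⟩ := exists_abs_le_of_abs_sub_le (fun α => (hl α).cdf_zero) one_pos hc b
  refine ⟨B + A, fun α => ?_⟩
  rw [← (hl α).cdf_sub hab]
  linarith [(abs_le.1 (hA α)).1, (abs_le.1 (hB α)).2]

end Limits

/-! ### Parametric b-measures built from limiting distribution functions. -/

section Construction

open MeasureTheory Topology Filter

variable {N : ℕ} {ω : ℕ+ → ℝ≥0 → ℝ≥0}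

/-- The part of a Stieltjes measure without atoms. -/
noncomputable def StieltjesFunction.contPart (f : StieltjesFunction ℝ) : Measure ℝ :=
  f.measure.restrict {x | Function.leftLim f x ≠ f x}ᶜ

theorem StieltjesFunction.isContMeasure_contPart (f : StieltjesFunction ℝ) :
    IsContMeasure f.contPart := by
  have : IsLocallyFiniteMeasure f.contPart :=
    ⟨fun x => (f.measure.finiteAt_nhds x).imp fun s hs =>
      ⟨hs.1, (Measure.restrict_apply_le _ _).trans_lt hs.2⟩⟩
  refine ⟨this, inferInstance, ⟨fun x => ?_⟩⟩
  unfold StieltjesFunction.contPart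
  rw [Measure.restrict_apply (measurableSet_singleton x)]
  by_cases hx : Function.leftLim f x = f x
  · refine measure_mono_null inter_subset_left ?_
    rw [StieltjesFunction.measure_singleton, hx, sub_self, ENNReal.ofReal_zero]
  · rw [singleton_inter_eq_empty.2 (notMem_compl_iff.2 hx), measure_empty]

/-- The atoms of `f.measure` form a countable set, on which `D` vanishes, so `D A` is unchanged when
they are removed from `A`. -/
theorem BMeasure.totalVar_le_contPart (D : BMeasure) (f : StieltjesFunction ℝ) (c : ℝ≥0)
    (h : ∀ A, IsBoundedBorel A → ENNReal.ofReal |D A| ≤ f.measure A * c) {A : Set ℝ}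
    (hA : IsBoundedBorel A) : D.totalVar A ≤ f.contPart A * c := by
  refine D.totalVar_le_of_forall (fun A hA => ?_) hA
  have hS := f.countable_leftLim_ne
  have hSm := hS.measurableSet
  have h1 : IsBoundedBorel (A ∩ {x | Function.leftLim f x ≠ f x}) :=
    hA.subset (hA.1.inter hSm) inter_subset_left
  have h2 : IsBoundedBorel (A ∩ {x | Function.leftLim f x ≠ f x}ᶜ) :=
    hA.subset (hA.1.inter hSm.compl) inter_subset_left
  have e : D A = D (A ∩ {x | Function.leftLim f x ≠ f x}ᶜ) := by
    conv_lhs => rw [← inter_union_compl A {x | Function.leftLim f x ≠ f x}]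
    rw [D.union_eq h1 h2 (disjoint_compl_right.mono inter_subset_right inter_subset_right),
      D.eq_zero_of_countable h1 (hS.mono inter_subset_right), zero_add]
  rw [e, StieltjesFunction.contPart, Measure.restrict_apply hA.1]
  exact h _ h2

theorem Monotone.tendsto_rightLim_add {f : ℝ → ℝ} (hf : Monotone f) (s : ℝ) :
    Tendsto (fun h => f (s + h)) (𝓝[>] 0) (𝓝 (Function.rightLim f s)) := by
  refine (hf.tendsto_rightLim s).comp (tendsto_nhdsWithin_iff.2 ⟨?_, ?_⟩)
  · have : Continuous fun h : ℝ => s + h := by fun_prop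
    simpa using (this.tendsto 0).mono_left nhdsWithin_le_nhds
  · filter_upwards [self_mem_nhdsWithin] with h hh
    exact lt_add_of_pos_right s hh

/-- A parametric b-measure is determined by distribution functions with the corresponding
bounds. -/
theorem exists_paramBMeasure (G : EuclideanSpace ℝ (Fin N) → ℝ → ℝ) (M L : ℕ+ → ℝ → ℝ)
    (hM : ∀ j, Continuous (M j)) (hL : ∀ j, Monotone (L j))
    (hGM : ∀ (j : ℕ+) x, ‖x‖ ≤ (j : ℝ) → ∀ s t, s ≤ t → |G x t - G x s| ≤ M j t - M j s)
    (hGL : ∀ (j : ℕ+) x z, ‖x‖ ≤ (j : ℝ) → ‖z‖ ≤ (j : ℝ) → ∀ s t, s ≤ t →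
      |(G x t - G x s) - (G z t - G z s)| ≤ (L j t - L j s) * ω j ‖x - z‖₊) :
    ∃ ν : ParamBMeasure N ω, ∀ x s t, s ≤ t → ν.1 x (Ioc s t) = G x t - G x s := by
  choose J hJ using exists_norm_le (N := N)
  have hMm : ∀ j, Monotone (M j) := fun j s t hst => by
    have := (abs_nonneg _).trans (hGM j 0 (by simp) s t hst)
    linarith
  have hG : ∀ x, Continuous (G x) := by
    refine fun x => continuous_iff_continuousAt.2 fun s => tendsto_iff_dist_tendsto_zero.2 ?_
    refine squeeze_zero (fun _ => dist_nonneg) (fun u => ?_)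
      (tendsto_iff_dist_tendsto_zero.1 ((hM (J x)).tendsto s))
    rw [Real.dist_eq, Real.dist_eq]
    rcases le_total u s with hu | hu
    · rw [abs_sub_comm, abs_sub_comm (M (J x) u)]
      exact (hGM _ x (hJ x) _ _ hu).trans (le_abs_self _)
    · exact (hGM _ x (hJ x) _ _ hu).trans (le_abs_self _)
  let g : ℕ+ → StieltjesFunction ℝ := fun j =>
    ⟨M j, hMm j, fun x => (hM j).continuousWithinAt⟩
  -- Adding `M (J x)` makes `G x` monotone; the b-measure is the difference of the two Stieltjes
  -- measures.
  let f : EuclideanSpace ℝ (Fin N) → StieltjesFunction ℝ := fun x =>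
    ⟨fun s => G x s + M (J x) s, fun s t hst => by
      have := (abs_le.1 (hGM _ x (hJ x) s t hst)).1
      linarith, fun s => ((hG x).add (hM (J x))).continuousWithinAt⟩
  have hf : ∀ x, IsContMeasure (f x).measure := fun x =>
    (f x).isContMeasure ((hG x).add (hM (J x)))
  have hg : ∀ j, IsContMeasure (g j).measure := fun j => (g j).isContMeasure (hM j)
  let ν : EuclideanSpace ℝ (Fin N) → BMeasure := fun x => BMeasure.ofDiff _ _ (hf x) (hg (J x))
  have hν : ∀ x A, IsBoundedBorel A →
      ν x A = (f x).measure.real A - (g (J x)).measure.real A := fun x A hA =>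
    BMeasure.ofDiff_apply _ _ hA
  refine ⟨⟨ν, fun j => ⟨⟨(g j).measure, hg j, fun A hA x hx => ?_⟩, ?_⟩⟩, fun x s t hst => ?_⟩
  · have h := (ν x).totalVar_le_of_forall (m := (g j).measure) (c := 1) (fun B hB => by
      rw [hν x B hB, mul_one]
      refine (f x).abs_real_sub_le (g (J x)) (g j) (fun s t hst => ?_) hB
      have e : (f x t - f x s) - (g (J x) t - g (J x) s) = G x t - G x s := by
        change (G x t + M (J x) t - (G x s + M (J x) s)) - (M (J x) t - M (J x) s) = _
        ring
      rw [e]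
      exact hGM j x hx s t hst) hA
    rwa [mul_one] at h
  · refine ⟨(hL j).stieltjesFunction.contPart,
      (hL j).stieltjesFunction.isContMeasure_contPart, fun A hA x z hx hz => ?_⟩
    refine (ν x - ν z).totalVar_le_contPart _ _ (fun B hB => ?_) hA
    -- Regrouped as a difference of two positive measures, whose distribution functions differ by `G
    -- x - G z`.
    have e : (ν x - ν z) B = (f x + g (J z)).measure.real B - (f z + g (J x)).measure.real B := by
      change ν x B - ν z B = _
      rw [hν x B hB, hν z B hB, StieltjesFunction.measure_add, StieltjesFunction.measure_add,
        measureReal_add_apply (hB.measure_lt_top _).ne (hB.measure_lt_top _).ne,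
        measureReal_add_apply (hB.measure_lt_top _).ne (hB.measure_lt_top _).ne]
      ring
    rw [e]
    refine ((f x + g (J z)).abs_real_sub_le _ (ω j ‖x - z‖₊ • (hL j).stieltjesFunction)
      (fun s t hst => ?_) hB).trans_eq ?_
    · have e' : ((f x + g (J z)) t - (f x + g (J z)) s) - ((f z + g (J x)) t - (f z + g (J x)) s) =
          (G x t - G x s) - (G z t - G z s) := by
        change ((G x t + M (J x) t + M (J z) t) - (G x s + M (J x) s + M (J z) s)) -
          ((G z t + M (J z) t + M (J x) t) - (G z s + M (J z) s + M (J x) s)) = _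
        ring
      rw [e']
      have hr : ((ω j ‖x - z‖₊ • (hL j).stieltjesFunction) t -
          (ω j ‖x - z‖₊ • (hL j).stieltjesFunction) s : ℝ) =
          (Function.rightLim (L j) t - Function.rightLim (L j) s) * ω j ‖x - z‖₊ := by
        change (ω j ‖x - z‖₊ : ℝ) * Function.rightLim (L j) t -
          (ω j ‖x - z‖₊ : ℝ) * Function.rightLim (L j) s = _
        ring
      rw [hr]
      have hGt : ∀ x s, Tendsto (fun h => G x (s + h)) (𝓝[>] 0) (𝓝 (G x s)) := fun x s => by
        have hc : Continuous fun h => G x (s + h) := (hG x).comp (by fun_prop)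
        simpa using (hc.tendsto 0).mono_left nhdsWithin_le_nhds
      -- The bound at `s + h` and `t + h` is passed to the limit `h ↓ 0`: `G` is continuous, while
      -- `L j` becomes its right limit.
      refine le_of_tendsto_of_tendsto'
        (((hGt x t).sub (hGt x s)).sub ((hGt z t).sub (hGt z s))).abs
        ((((hL j).tendsto_rightLim_add t).sub ((hL j).tendsto_rightLim_add s)).mul_const _)
        fun h => hGL j x z hx hz (s + h) (t + h) (by linarith)
    · rw [StieltjesFunction.measure_smul, Measure.smul_apply, mul_comm]
      rfl
  · change ν x (Ioc s t) = _
    rw [hν x _ (isBoundedBorel_Ioc s t), Measure.real, Measure.real,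
      StieltjesFunction.measure_Ioc, StieltjesFunction.measure_Ioc,
      ENNReal.toReal_ofReal (sub_nonneg.2 ((f x).mono hst)),
      ENNReal.toReal_ofReal (sub_nonneg.2 ((g (J x)).mono hst))]
    change (G x t + M (J x) t - (G x s + M (J x) s)) - (M (J x) t - M (J x) s) = _
    ring

/-- Families with equicontinuous `m`-bounds and bounded `l`-bounds have limits along
ultrafilters. -/
theorem exists_tendsto_apply_Ioc (hω : IsModuliFamily ω) {Γ : Type*} {ν : Γ → ParamBMeasure N ω}
    (hm : FamilyEquicontMBounds ν) (hl : FamilyBoundedLBounds ν) (F : Ultrafilter Γ) :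
    ∃ ν' : ParamBMeasure N ω, ∀ x s t, s ≤ t →
      Tendsto (fun α => (ν α).1 x (Ioc s t)) F (𝓝 (ν'.1 x (Ioc s t))) := by
  obtain ⟨m, hm⟩ := hm
  obtain ⟨l, hl⟩ := hl
  have hmc : ∀ j α, IsContMeasure (m j α) := fun j α => ((hm j).1 α).1
  have hlc : ∀ j α, IsContMeasure (l j α) := fun j α => ((hl j).1 α).1
  have hG : ∀ x, ∃ g : ℝ → ℝ, ∀ s, Tendsto (fun α => ((ν α).1 x).cdf s) F (𝓝 (g s)) := by
    intro x
    obtain ⟨j, hj⟩ := exists_norm_le x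
    obtain ⟨δ, hδ, h⟩ := exists_forall_abs_apply_Ioc_le (hm j).1 (hm j).2 one_pos
    refine exists_tendsto_of_abs_sub_le (fun α => BMeasure.cdf_zero _) hδ (c := 1)
      (fun α s t hst hst' => ?_) F
    rw [← BMeasure.apply_Ioc _ hst]
    exact h α x hj s t hst hst'
  have hmδ : ∀ j, ∀ ε > 0, ∃ δ > 0, ∀ α s t, s ≤ t → t - s < δ →
      |(hmc j α).cdf t - (hmc j α).cdf s| ≤ ε := by
    intro j ε hε
    obtain ⟨δ, hδ, h⟩ := (hm j).2 ε hε
    refine ⟨δ, hδ, fun α s t hst hst' => ?_⟩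
    rw [(hmc j α).cdf_sub hst, abs_of_nonneg measureReal_nonneg]
    refine ENNReal.toReal_le_of_le_ofReal hε.le ?_
    exact (measure_mono Ioc_subset_Icc_self).trans (h s t (sub_nonneg.2 hst) hst' α).le
  have hM : ∀ j, ∃ g : ℝ → ℝ, ∀ s, Tendsto (fun α => (hmc j α).cdf s) F (𝓝 (g s)) := by
    intro j
    obtain ⟨δ, hδ, h⟩ := hmδ j 1 one_pos
    exact exists_tendsto_of_abs_sub_le (fun α => IsContMeasure.cdf_zero _) hδ h F
  have hL : ∀ j, ∃ g : ℝ → ℝ, ∀ s, Tendsto (fun α => (hlc j α).cdf s) F (𝓝 (g s)) := by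
    intro j
    obtain ⟨c, h⟩ := (hl j).2.abs_cdf_sub_le (hlc j)
    exact exists_tendsto_of_abs_sub_le (fun α => IsContMeasure.cdf_zero _) one_pos h F
  choose G hG using hG
  choose M hM using hM
  choose L hL using hL
  have hν : ∃ ν' : ParamBMeasure N ω, ∀ x s t, s ≤ t → ν'.1 x (Ioc s t) = G x t - G x s := by
    refine exists_paramBMeasure G M L ?_ ?_ ?_ ?_
    · intro j
      refine Metric.continuous_iff.2 fun b ε hε => ?_
      obtain ⟨δ, hδ, h⟩ := hmδ j (ε / 2) (half_pos hε)
      -- The uniform `δ` survives the pointwise limit, so `M j` is continuous.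
      have h' : ∀ s t, s ≤ t → t - s < δ → |M j t - M j s| ≤ ε / 2 := fun s t hst hst' =>
        le_of_tendsto' ((hM j t).sub (hM j s)).abs fun α => h α s t hst hst'
      refine ⟨δ, hδ, fun a hab => lt_of_le_of_lt ?_ (half_lt_self hε)⟩
      rw [Real.dist_eq, abs_lt] at hab
      rw [Real.dist_eq]
      rcases le_total a b with hle | hle
      · rw [abs_sub_comm]
        exact h' a b hle (by linarith)
      · exact h' b a hle (by linarith)
    · intro j s t hst
      refine le_of_tendsto_of_tendsto' (hL j s) (hL j t) fun α => ?_
      rw [← sub_nonneg, (hlc j α).cdf_sub hst]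
      exact measureReal_nonneg
    · intro j x hx s t hst
      refine le_of_tendsto_of_tendsto' ((hG x t).sub (hG x s)).abs ((hM j t).sub (hM j s))
        fun α => ?_
      rw [← BMeasure.apply_Ioc _ hst, (hmc j α).cdf_sub hst]
      exact ((hm j).1 α).abs_le (isBoundedBorel_Ioc s t) hx
    · intro j x z hx hz s t hst
      refine le_of_tendsto_of_tendsto'
        (((hG x t).sub (hG x s)).sub ((hG z t).sub (hG z s))).abs
        (((hL j t).sub (hL j s)).mul_const _) fun α => ?_
      rw [← BMeasure.apply_Ioc _ hst, ← BMeasure.apply_Ioc _ hst, (hlc j α).cdf_sub hst]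
      exact ((hl j).1 α).abs_sub_le hω (isBoundedBorel_Ioc s t) hx hz le_rfl
  obtain ⟨ν', hν'⟩ := hν
  refine ⟨ν', fun x s t hst => ?_⟩
  rw [hν' x s t hst]
  simp only [BMeasure.apply_Ioc _ hst]
  exact (hG x t).sub (hG x s)

end Construction

/-! ### Convergence in the topologies and compactness of the hull. -/

section Compactness

open MeasureTheory Topology Filter

variable {N : ℕ} {ω : ℕ+ → ℝ≥0 → ℝ≥0} {θ : ℕ+ → ℚ → ℚ → ℝ≥0 → ℝ≥0}
  {Γ : Type*} {F : Filter Γ} {κ : Γ → ParamBMeasure N ω} {ν : ParamBMeasure N ω}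

/-- Pointwise convergence on a finite `η`-net of the ball is enough: the l-bounds, uniform in `α`,
carry it to the other parameters. -/
theorem eventually_forall_abs_apply_Ioc_sub_le (hω : IsModuliFamily ω) {j : ℕ+}
    {l : Γ → Measure ℝ} (hl : ∀ α, IsLBound ω (κ α).1 j (l α)) {s t C : ℝ}
    (hC : ∀ α, (l α).real (Ioc s t) ≤ C)
    (h : ∀ x, Tendsto (fun α => (κ α).1 x (Ioc s t)) F (𝓝 (ν.1 x (Ioc s t)))) {ε : ℝ}
    (hε : 0 < ε) : ∀ᶠ α in F, ∀ x : EuclideanSpace ℝ (Fin N), ‖x‖ ≤ (j : ℝ) →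
      |(κ α).1 x (Ioc s t) - ν.1 x (Ioc s t)| ≤ ε := by
  obtain ⟨-, L, hL⟩ := ν.2 j
  obtain ⟨η, hη, hη'⟩ := hω.exists_mul_lt j (max C (L.real (Ioc s t))) 0
    (show 0 < ε / 3 by positivity)
  have hlt := hη' η le_rfl
  rw [zero_add, hω.zero j, NNReal.coe_zero, mul_zero, zero_add] at hlt
  obtain ⟨Z, hZ, hZf, hZc⟩ := (isCompact_closedBall (0 : EuclideanSpace ℝ (Fin N))
    (j : ℝ)).finite_cover_balls (show 0 < (η : ℝ) from hη)
  filter_upwards [(hZf.eventually_all).2 fun z _ =>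
    Metric.tendsto_nhds.1 (h z) (ε / 3) (by positivity)] with α hα x hx
  obtain ⟨z, hzZ, hxz⟩ := mem_iUnion₂.1 (hZc (mem_closedBall_zero_iff.2 hx))
  have hz := mem_closedBall_zero_iff.1 (hZ hzZ)
  have hxz' : ‖x - z‖ ≤ η := by
    rw [← dist_eq_norm]
    exact (Metric.mem_ball.1 hxz).le
  have h1 := (hl α).abs_sub_le hω (isBoundedBorel_Ioc s t) hx hz hxz'
  have h2 := hL.abs_sub_le hω (isBoundedBorel_Ioc s t) hx hz hxz'
  have h3 := mul_le_mul_of_nonneg_right ((hC α).trans (le_max_left C (L.real (Ioc s t))))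
    (ω j η).coe_nonneg
  have h4 := mul_le_mul_of_nonneg_right (le_max_right C (L.real (Ioc s t))) (ω j η).coe_nonneg
  have h5 := hα z hzZ
  rw [Real.dist_eq, abs_lt] at h5
  rw [abs_le] at *
  constructor <;> linarith

/-- The common modulus lets one partition approximate the integrals along all admissible curves at
once, uniformly in `α`. There remain finitely many intervals, on which convergence is uniform in the
parameter. -/
theorem tendsto_sigmaTheta_of_tendsto_apply (hω : IsModuliFamily ω) (hθ : IsSuitable θ)
    (hl : FamilyBoundedLBounds κ) (h : ∀ x s t, s ≤ t →
      Tendsto (fun α => (κ α).1 x (Ioc s t)) F (𝓝 (ν.1 x (Ioc s t)))) :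
    Tendsto κ F (@nhds _ (sigmaTheta N ω θ) ν) := by
  rw [sigmaTheta_eq hω, tendsto_seminormTopology_iff]
  rintro ⟨j, ⟨⟨a, b⟩, hab : a < b⟩⟩
  have hab' : (a : ℝ) < b := Rat.cast_lt.2 hab
  obtain ⟨l, hl⟩ := hl
  have hlc : ∀ j α, IsContMeasure (l j α) := fun j α => ((hl j).1 α).1
  refine Metric.tendsto_nhds.2 fun ε hε => ?_
  have hε4 : 0 < ε / 4 := by positivity
  obtain ⟨C, hC⟩ := (hl j).2.exists_real_Ioc_le (hlc j) hab'.le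
  obtain ⟨-, L, hL⟩ := ν.2 j
  obtain ⟨η, hη, hη'⟩ := hω.exists_mul_lt j (max C (L.real (Ioc (a : ℝ) b))) 0 hε4
  have hlt := hη' η le_rfl
  rw [zero_add, hω.zero j, NNReal.coe_zero, mul_zero, zero_add] at hlt
  obtain ⟨ρ, hρ, hρ'⟩ := hθ.exists_le j hab hη
  obtain ⟨n, t, τ, hP⟩ := exists_isTaggedPartition hab' (show 0 < (ρ : ℝ) from hρ)
  have hev : ∀ᶠ α in F, ∀ i : Fin n, ∀ x : EuclideanSpace ℝ (Fin N), ‖x‖ ≤ (j : ℝ) →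
      |(κ α).1 x (Ioc (t i) (t (i + 1))) - ν.1 x (Ioc (t i) (t (i + 1)))| ≤ ε / 4 / (n + 1) := by
    refine eventually_all.2 fun i => ?_
    have hi := (hP.lt i i.2).le
    obtain ⟨C', hC'⟩ := (hl j).2.exists_real_Ioc_le (hlc j) hi
    exact eventually_forall_abs_apply_Ioc_sub_le hω (hl j).1 hC' (fun x => h x _ _ hi)
      (by positivity)
  filter_upwards [hev] with α hα
  rw [Real.dist_eq, sub_zero]
  have hle : (seminormTheta θ j a b (κ α - ν)).toReal ≤ 3 * (ε / 4) := by
    refine toReal_seminormTheta_le _ (by positivity) fun y hy => ?_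
    rw [paramIntegral_sub hω hab' _ _ hy.1 hy.2.1]
    have hτ : ∀ i : Fin n, τ i ∈ Icc (a : ℝ) b := fun i => hP.mem_Icc i.2
    have hosc : ∀ i : Fin n, ∀ s ∈ Ioc (t i) (t (i + 1)), ‖y (τ i) - y s‖ ≤ η := by
      intro i s hs
      have hs' := Ioc_subset_Icc_self (hP.isBorelPartition.subset i hs)
      refine (NNReal.coe_le_coe.2 (hy.2.2 _ (hτ i) _ hs')).trans
        (NNReal.coe_le_coe.2 ((hθ.monotone j a b hab ?_).trans hρ'))
      change |τ i - s| ≤ (ρ : ℝ)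
      have h1 := hP.tag i i.2
      have h2 := hP.mesh i i.2
      rw [abs_le]
      constructor <;> linarith [h1.1, h1.2, hs.1, hs.2]
    have k1 := abs_paramIntegral_sub_sum_le (ν := κ α) hω hab' ((hl j).1 α) hy.1 hy.2.1
      hP.isBorelPartition (x := fun i => y (τ i)) (fun i => hy.2.1 _ (hτ i)) hosc
    have k2 := abs_paramIntegral_sub_sum_le (ν := ν) hω hab' hL hy.1 hy.2.1
      hP.isBorelPartition (x := fun i => y (τ i)) (fun i => hy.2.1 _ (hτ i)) hosc
    have k3 := mul_le_mul_of_nonneg_right ((hC α).trans (le_max_left C (L.real (Ioc (a : ℝ) b))))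
      (ω j η).coe_nonneg
    have k4 := mul_le_mul_of_nonneg_right (le_max_right C (L.real (Ioc (a : ℝ) b)))
      (ω j η).coe_nonneg
    have k5 : |∑ i : Fin n, (κ α).1 (y (τ i)) (Ioc (t i) (t (i + 1))) -
        ∑ i : Fin n, ν.1 (y (τ i)) (Ioc (t i) (t (i + 1)))| ≤ ε / 4 := by
      rw [← Finset.sum_sub_distrib]
      refine (Finset.abs_sum_le_sum_abs _ _).trans ((Finset.sum_le_sum fun i _ =>
        hα i (y (τ i)) (hy.2.1 _ (hτ i))).trans ?_)
      rw [Finset.sum_const, Finset.card_univ, Fintype.card_fin, nsmul_eq_mul, mul_div_assoc',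
        div_le_iff₀ (by positivity)]
      linarith
    rw [abs_le] at *
    constructor <;> linarith
  refine lt_of_le_of_lt (b := 3 * (ε / 4)) ?_ (by linarith)
  exact (abs_of_nonneg ENNReal.toReal_nonneg).trans_le hle

theorem isCompact_hull [TopologicalSpace (ParamBMeasure N ω)] [RegularSpace (ParamBMeasure N ω)]
    (hω : IsModuliFamily ω) {ν₀ : ParamBMeasure N ω} (hm : HasEquicontMBounds ν₀)
    (hl : HasBoundedLBounds ν₀)
    (hlim : ∀ (F : Filter ℝ) (ν : ParamBMeasure N ω), (∀ x s t, s ≤ t →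
      Tendsto (fun u => (ParamBMeasure.translate ν₀ u).1 x (Ioc s t)) F (𝓝 (ν.1 x (Ioc s t)))) →
      Tendsto (fun u => ParamBMeasure.translate ν₀ u) F (𝓝 ν)) : IsCompact (hull ν₀) := by
  refine isCompact_closure_of_ultrafilter fun F hF => ?_
  let f : ℝ → ParamBMeasure N ω := fun u => ParamBMeasure.translate ν₀ u
  -- An ultrafilter containing the orbit is the image of an ultrafilter of times, along which limits
  -- of values on intervals exist.
  have hne : (comap f (F : Filter _)).NeBot := comap_neBot_iff_compl_range.2 fun hc =>
    Ultrafilter.compl_notMem_iff.2 hF hc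
  have hmap : (Ultrafilter.of (comap f (F : Filter _))).map f = F :=
    Ultrafilter.coe_le_coe.1 (map_le_iff_le_comap.2 (Ultrafilter.of_le _))
  obtain ⟨ν, hν⟩ := exists_tendsto_apply_Ioc hω hm hl (Ultrafilter.of (comap f (F : Filter _)))
  refine ⟨ν, ?_⟩
  rw [← hmap]
  exact hlim _ ν hν

end Compactness

theorem mainTheorem4 (N : ℕ) (ω : ℕ+ → ℝ≥0 → ℝ≥0) (hω : IsModuliFamily ω)
    [T : TopologicalSpace (ParamBMeasure N ω)]
    (hT : (∃ θ : ℕ+ → ℚ → ℚ → ℝ≥0 → ℝ≥0, IsSuitable θ ∧ T = sigmaTheta N ω θ) ∨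
      (∃ D : Set (EuclideanSpace ℝ (Fin N)), D.Countable ∧ Dense D ∧ T = sigmaD N ω D))
    (ν₀ : ParamBMeasure N ω) (hm : HasEquicontMBounds ν₀) :
    (∃ φ : Flow ℝ (hull ν₀), ∀ (t : ℝ) (ν : hull ν₀),
      (φ t ν : ParamBMeasure N ω) = ParamBMeasure.translate (ν : ParamBMeasure N ω) t) ∧
    (HasBoundedLBounds ν₀ → IsCompact (hull ν₀)) := by
  rcases hT with ⟨θ, hθ, hT⟩ | ⟨D, -, -, hT⟩
  · refine ⟨exists_flow_hull_sigmaTheta hω hθ hm hT, fun hl => ?_⟩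
    have : RegularSpace (ParamBMeasure N ω) := by
      rw [hT, sigmaTheta_eq hω]
      exact regularSpace_seminormTopology _
    refine isCompact_hull hω hm hl fun F ν h => ?_
    rw [hT]
    exact tendsto_sigmaTheta_of_tendsto_apply hω hθ hl h
  · refine ⟨exists_flow_hull_sigmaD hm hT, fun hl => ?_⟩
    have : RegularSpace (ParamBMeasure N ω) := by
      rw [hT, sigmaD_eq]
      exact regularSpace_seminormTopology _
    refine isCompact_hull hω hm hl fun F ν h => ?_
    rw [hT]
    exact tendsto_sigmaD_iff.2 fun x _ q₁ q₂ hq => h x q₁ q₂ (Rat.cast_le.2 hq.le)
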